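/- **Language.** Formulas are built from countably many propositional variables and the constants $\top,\bot,1,0$ with the binary connectives $\land,\lor,\cdot,\to$. A *sequent* $X\Rightarrow\Pi$ consists of a finite multiset $X$ of formulas and of $\Pi$, which is a formula or empty; a *hypersequent* is a finite, possibly empty, multiset of sequents, written $X_1\Rightarrow\Pi_1\mid\dots\mid X_n\Rightarrow\Pi_n$. Below, $H$ ranges over hypersequents, $X,Y$ over finite multisets of formulas, $A,B$ over formulas, and $\Pi$ over formulas or the empty succedent. **Calculus.** $\mathrm{HFL}_{elw}=\mathrm{HFL}_e+(lw)$ is the cut-free hypersequent calculus with the following rules. - Initial hypersequents: $H\mid A\Rightarrow A$; $\;H\mid \bot,X\Rightarrow\Pi$; $\;H\mid X\Rightarrow\top$; $\;H\mid 0\Rightarrow$; $\;H\mid\ \Rightarrow 1$. - Constants: from $H\mid X\Rightarrow\Pi$ infer $H\mid 1,X\Rightarrow\Pi$; from $H\mid X\Rightarrow$ infer $H\mid X\Rightarrow 0$. - External contraction (EC): from $H\mid X\Rightarrow\Pi\mid X\Rightarrow\Pi$ infer $H\mid X\Rightarrow\Pi$. External weakening (EW): from $H$ infer $H\mid X\Rightarrow\Pi$.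 - $(\cdot)$: from $H\mid X,A,B\Rightarrow\Pi$ infer $H\mid X,A\cdot B\Rightarrow\Pi$; from $H\mid X\Rightarrow A$ and $H\mid Y\Rightarrow B$ infer $H\mid X,Y\Rightarrow A\cdot B$. - $(\lor)$: from $H\mid X,A\Rightarrow\Pi$ and $H\mid X,B\Rightarrow\Pi$ infer $H\mid X,A\lor B\Rightarrow\Pi$; from $H\mid X\Rightarrow A$, or from $H\mid X\Rightarrow B$, infer $H\mid X\Rightarrow A\lor B$. - $(\land)$: from $H\mid X,A\Rightarrow\Pi$, or from $H\mid X,B\Rightarrow\Pi$, infer $H\mid X,A\land B\Rightarrow\Pi$; from $H\mid X\Rightarrow A$ and $H\mid X\Rightarrow B$ infer $H\mid X\Rightarrow A\land B$. - $(\to)$: from $H\mid X\Rightarrow A$ and $H\mid Y,B\Rightarrow\Pi$ infer $H\mid X,Y,A\to B\Rightarrow\Pi$; from $H\mid X,A\Rightarrow B$ infer $H\mid X\Rightarrow A\to B$. - Left weakening (lw): from $H\mid X\Rightarrow\Pi$ infer $H\mid X,A\Rightarrow\Pi$. **Analytic structural rules.** An *analytic structural rule schema* is given by finite index sets $I,J,L$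 and $K_i$ ($i\in I$), pairwise distinct succedent-variables $\Pi_i$ ($i\in I$), pairwise distinct multiset-variables $Y_i$, $X_{i1},\dots,X_{is_i}$ ($i\in I$) and $Z_{j1},\dots,Z_{jt_j}$ ($j\in J$), and lists $\mathcal L_{ik}$ ($i\in I,k\in K_i$) and $\mathcal M_l$ ($l\in L$) of these multiset-variables. It allows one to infer $$H\mid Y_i,X_{i1},\dots,X_{is_i}\Rightarrow\Pi_i\ (i\in I)\mid Z_{j1},\dots,Z_{jt_j}\Rightarrow\ (j\in J)$$ from the premises $H\mid Y_i,\mathcal L_{ik}\Rightarrow\Pi_i$ ($i\in I,k\in K_i$) and $H\mid\mathcal M_l\Rightarrow$ ($l\in L$), for every instantiation of $H$ by a hypersequent, of the multiset-variables by finite multisets of formulas, and of the succedent-variables by a formula or the empty succedent. **Theorem.** Let $R$ be a finite set of analytic structural rule schemas. Then the calculus $\mathrm{HFL}_{elw}+R$ is decidable: there is an algorithm that determines, for every hypersequent $h$ given as input, whether $h$ is derivable in $\mathrm{HFL}_{elw}+R$. In particular, every logic $L$ for which $\mathrm{HFL}_{elw}+R$ is a calculus (that is, for every formula $B$: $B\in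 L$ if and only if $\;\Rightarrow B$ is derivable in $\mathrm{HFL}_{elw}+R$) is decidable: there is an algorithm that determines, for every formula $B$, whether $B\in L$. -/

import Mathlib

namespace HFL

/-- Formulas over the countably infinite set of propositional variables `var 0, var 1, …`. -/
inductive Form : Type
  | top : Form
  | bot : Form
  | one : Form
  | zero : Form
  | var (n : ℕ) : Form
  | conj (A B : Form) : Form
  | disj (A B : Form) : Form
  | fusion (A B : Form) : Form
  | imp (A B : Form) : Form
  deriving DecidableEq

namespace Form

/-- An explicit Gödel numbering of formulas. -/
def toCode : Form → ℕ
  | top => 0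
  | bot => 1
  | one => 2
  | zero => 3
  | var n => 5 * n + 4
  | conj A B => 5 * Nat.pair A.toCode B.toCode + 5
  | disj A B => 5 * Nat.pair A.toCode B.toCode + 6
  | fusion A B => 5 * Nat.pair A.toCode B.toCode + 7
  | imp A B => 5 * Nat.pair A.toCode B.toCode + 8

/-- The formula with a given Gödel number. -/
def ofCode : ℕ → Form
  | 0 => top
  | 1 => bot
  | 2 => one
  | 3 => zero
  | n + 4 =>
    have h1 : (Nat.unpair (n / 5)).1 < n + 4 :=
      lt_of_le_of_lt (Nat.unpair_left_le _) (by omega)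
    have h2 : (Nat.unpair (n / 5)).2 < n + 4 :=
      lt_of_le_of_lt (Nat.unpair_right_le _) (by omega)
    match n % 5 with
    | 0 => var (n / 5)
    | 1 => conj (ofCode (Nat.unpair (n / 5)).1) (ofCode (Nat.unpair (n / 5)).2)
    | 2 => disj (ofCode (Nat.unpair (n / 5)).1) (ofCode (Nat.unpair (n / 5)).2)
    | 3 => fusion (ofCode (Nat.unpair (n / 5)).1) (ofCode (Nat.unpair (n / 5)).2)
    | _ => imp (ofCode (Nat.unpair (n / 5)).1) (ofCode (Nat.unpair (n / 5)).2)

theorem ofCode_toCode (A : Form) : ofCode A.toCode = A := by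
  induction A with
  | top => simp [toCode, ofCode]
  | bot => simp [toCode, ofCode]
  | one => simp [toCode, ofCode]
  | zero => simp [toCode, ofCode]
  | var n => simp [toCode, ofCode]
  | conj A B hA hB =>
    have e : toCode (conj A B) = (5 * Nat.pair A.toCode B.toCode + 1) + 4 := rfl
    have e1 : (5 * Nat.pair A.toCode B.toCode + 1) / 5 = Nat.pair A.toCode B.toCode := by omega
    have e2 : (5 * Nat.pair A.toCode B.toCode + 1) % 5 = 1 := by omega
    rw [e, ofCode, e1, e2]
    simp [hA, hB]
  | disj A B hA hB =>
    have e : toCode (disj A B) = (5 * Nat.pair A.toCode B.toCode + 2) + 4 := rfl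
    have e1 : (5 * Nat.pair A.toCode B.toCode + 2) / 5 = Nat.pair A.toCode B.toCode := by omega
    have e2 : (5 * Nat.pair A.toCode B.toCode + 2) % 5 = 2 := by omega
    rw [e, ofCode, e1, e2]
    simp [hA, hB]
  | fusion A B hA hB =>
    have e : toCode (fusion A B) = (5 * Nat.pair A.toCode B.toCode + 3) + 4 := rfl
    have e1 : (5 * Nat.pair A.toCode B.toCode + 3) / 5 = Nat.pair A.toCode B.toCode := by omega
    have e2 : (5 * Nat.pair A.toCode B.toCode + 3) % 5 = 3 := by omega
    rw [e, ofCode, e1, e2]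
    simp [hA, hB]
  | imp A B hA hB =>
    have e : toCode (imp A B) = (5 * Nat.pair A.toCode B.toCode + 4) + 4 := rfl
    have e1 : (5 * Nat.pair A.toCode B.toCode + 4) / 5 = Nat.pair A.toCode B.toCode := by omega
    have e2 : (5 * Nat.pair A.toCode B.toCode + 4) % 5 = 4 := by omega
    rw [e, ofCode, e1, e2]
    simp [hA, hB]

theorem toCode_ofCode (n : ℕ) : (ofCode n).toCode = n := by
  induction n using Nat.strong_induction_on with
  | _ n ih =>
    match n with
    | 0 => simp [toCode, ofCode]
    | 1 => simp [toCode, ofCode]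
    | 2 => simp [toCode, ofCode]
    | 3 => simp [toCode, ofCode]
    | n + 4 =>
      have h1 := ih (Nat.unpair (n / 5)).1
        (lt_of_le_of_lt (Nat.unpair_left_le _) (by omega))
      have h2 := ih (Nat.unpair (n / 5)).2
        (lt_of_le_of_lt (Nat.unpair_right_le _) (by omega))
      have hlt : n % 5 < 5 := Nat.mod_lt _ (by norm_num)
      have hdm := Nat.div_add_mod n 5
      rw [ofCode]
      generalize hr : n % 5 = r at *
      interval_cases r <;> simp only [toCode, h1, h2, Nat.pair_unpair] <;> omega

instance : Denumerable Form :=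
  Denumerable.mk' ⟨toCode, ofCode, ofCode_toCode, toCode_ofCode⟩

end Form

/-- A sequent `X ⇒ Π`: a finite multiset of formulas and at most one formula. -/
structure Sequent : Type where
  ant : Multiset Form
  suc : Option Form

infix:45 " ⇛ " => Sequent.mk

/-- A hypersequent: a finite (possibly empty) multiset of sequents. -/
abbrev Hypersequent : Type := Multiset Sequent

/-- The pairwise distinct multiset-variables `Y i` (`i ∈ I`), `X i k` (`i ∈ I`, `k < s i`) and
`Z j k` (`j ∈ J`, `k < t j`) of an analytic structural rule schema; `I = Fin nI`, `J = Fin nJ`. -/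
inductive MVar (nI nJ : ℕ) (s : Fin nI → ℕ) (t : Fin nJ → ℕ) : Type
  | Y (i : Fin nI) : MVar nI nJ s t
  | X (i : Fin nI) (k : Fin (s i)) : MVar nI nJ s t
  | Z (j : Fin nJ) (k : Fin (t j)) : MVar nI nJ s t

/-- An analytic structural rule schema: from the premises
`H | Y i, 𝓛 ⇒ Π i` (`i ∈ I`, `𝓛` in the finite list `premI i`) and
`H | 𝓜 ⇒` (`𝓜` in the finite list `premL`) infer
`H | Y i, X i 1, …, X i (s i) ⇒ Π i (i ∈ I) | Z j 1, …, Z j (t j) ⇒ (j ∈ J)`,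
where every `𝓛` and every `𝓜` is a list of the multiset-variables of the schema. -/
structure AnalyticRule : Type where
  nI : ℕ
  nJ : ℕ
  s : Fin nI → ℕ
  t : Fin nJ → ℕ
  premI : Fin nI → List (List (MVar nI nJ s t))
  premL : List (List (MVar nI nJ s t))

namespace AnalyticRule

/-- The multiset-variables of a schema. -/
abbrev Var (r : AnalyticRule) : Type := MVar r.nI r.nJ r.s r.t

/-- The premises of the instance of `r` in which the hypersequent-variable is instantiated by `H`,
the multiset-variables by `m`, and the succedent-variables by `p`. -/
def premises (r : AnalyticRule) (H : Hypersequent) (m : r.Var → Multiset Form)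
    (p : Fin r.nI → Option Form) : List Hypersequent :=
  ((List.finRange r.nI).flatMap fun i =>
    (r.premI i).map fun l => (m (MVar.Y i) + (l.map m).sum ⇛ p i) ::ₘ H) ++
  r.premL.map fun l => ((l.map m).sum ⇛ none) ::ₘ H

/-- The conclusion of the instance of `r` given by `H`, `m` and `p`. -/
def conclusion (r : AnalyticRule) (H : Hypersequent) (m : r.Var → Multiset Form)
    (p : Fin r.nI → Option Form) : Hypersequent :=
  H + (Finset.univ : Finset (Fin r.nI)).val.map
        (fun i => (m (MVar.Y i) + ∑ k, m (MVar.X i k) ⇛ p i))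
    + (Finset.univ : Finset (Fin r.nJ)).val.map
        (fun j => (∑ k, m (MVar.Z j k) ⇛ none))

end AnalyticRule

/-- Derivability in the (cut-free) hypersequent calculus `HFL_e + (lw) + R`, for a set `R` of
analytic structural rule schemas. -/
inductive Derivable (R : Set AnalyticRule) : Hypersequent → Prop
  | id (H : Hypersequent) (A : Form) :
      Derivable R (({A} ⇛ some A) ::ₘ H)
  | botL (H : Hypersequent) (X : Multiset Form) (P : Option Form) :
      Derivable R ((Form.bot ::ₘ X ⇛ P) ::ₘ H)
  | topR (H : Hypersequent) (X : Multiset Form) :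
      Derivable R ((X ⇛ some Form.top) ::ₘ H)
  | zeroL (H : Hypersequent) :
      Derivable R (({Form.zero} ⇛ none) ::ₘ H)
  | oneR (H : Hypersequent) :
      Derivable R ((0 ⇛ some Form.one) ::ₘ H)
  | oneL (H : Hypersequent) (X : Multiset Form) (P : Option Form) :
      Derivable R ((X ⇛ P) ::ₘ H) →
      Derivable R ((Form.one ::ₘ X ⇛ P) ::ₘ H)
  | zeroR (H : Hypersequent) (X : Multiset Form) :
      Derivable R ((X ⇛ none) ::ₘ H) →
      Derivable R ((X ⇛ some Form.zero) ::ₘ H)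
  | ec (H : Hypersequent) (X : Multiset Form) (P : Option Form) :
      Derivable R ((X ⇛ P) ::ₘ (X ⇛ P) ::ₘ H) →
      Derivable R ((X ⇛ P) ::ₘ H)
  | ew (H : Hypersequent) (X : Multiset Form) (P : Option Form) :
      Derivable R H →
      Derivable R ((X ⇛ P) ::ₘ H)
  | fusionL (H : Hypersequent) (X : Multiset Form) (A B : Form) (P : Option Form) :
      Derivable R ((A ::ₘ B ::ₘ X ⇛ P) ::ₘ H) →
      Derivable R ((Form.fusion A B ::ₘ X ⇛ P) ::ₘ H)
  | fusionR (H : Hypersequent) (X Y : Multiset Form) (A B : Form) :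
      Derivable R ((X ⇛ some A) ::ₘ H) →
      Derivable R ((Y ⇛ some B) ::ₘ H) →
      Derivable R ((X + Y ⇛ some (Form.fusion A B)) ::ₘ H)
  | disjL (H : Hypersequent) (X : Multiset Form) (A B : Form) (P : Option Form) :
      Derivable R ((A ::ₘ X ⇛ P) ::ₘ H) →
      Derivable R ((B ::ₘ X ⇛ P) ::ₘ H) →
      Derivable R ((Form.disj A B ::ₘ X ⇛ P) ::ₘ H)
  | disjR1 (H : Hypersequent) (X : Multiset Form) (A B : Form) :
      Derivable R ((X ⇛ some A) ::ₘ H) →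
      Derivable R ((X ⇛ some (Form.disj A B)) ::ₘ H)
  | disjR2 (H : Hypersequent) (X : Multiset Form) (A B : Form) :
      Derivable R ((X ⇛ some B) ::ₘ H) →
      Derivable R ((X ⇛ some (Form.disj A B)) ::ₘ H)
  | conjL1 (H : Hypersequent) (X : Multiset Form) (A B : Form) (P : Option Form) :
      Derivable R ((A ::ₘ X ⇛ P) ::ₘ H) →
      Derivable R ((Form.conj A B ::ₘ X ⇛ P) ::ₘ H)
  | conjL2 (H : Hypersequent) (X : Multiset Form) (A B : Form) (P : Option Form) :
      Derivable R ((B ::ₘ X ⇛ P) ::ₘ H) →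
      Derivable R ((Form.conj A B ::ₘ X ⇛ P) ::ₘ H)
  | conjR (H : Hypersequent) (X : Multiset Form) (A B : Form) :
      Derivable R ((X ⇛ some A) ::ₘ H) →
      Derivable R ((X ⇛ some B) ::ₘ H) →
      Derivable R ((X ⇛ some (Form.conj A B)) ::ₘ H)
  | impL (H : Hypersequent) (X Y : Multiset Form) (A B : Form) (P : Option Form) :
      Derivable R ((X ⇛ some A) ::ₘ H) →
      Derivable R ((B ::ₘ Y ⇛ P) ::ₘ H) →
      Derivable R ((Form.imp A B ::ₘ (X + Y) ⇛ P) ::ₘ H)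
  | impR (H : Hypersequent) (X : Multiset Form) (A B : Form) :
      Derivable R ((A ::ₘ X ⇛ some B) ::ₘ H) →
      Derivable R ((X ⇛ some (Form.imp A B)) ::ₘ H)
  | lw (H : Hypersequent) (X : Multiset Form) (A : Form) (P : Option Form) :
      Derivable R ((X ⇛ P) ::ₘ H) →
      Derivable R ((A ::ₘ X ⇛ P) ::ₘ H)
  | ext (r : AnalyticRule) (hr : r ∈ R) (H : Hypersequent) (m : r.Var → Multiset Form)
      (p : Fin r.nI → Option Form) :
      (∀ g ∈ r.premises H m p, Derivable R g) →
      Derivable R (r.conclusion H m p)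

/-- A written hypersequent: a list of sequents, each written as the list of the formulas of its
antecedent together with its succedent. This is the input format of the decision problem. -/
abbrev Written : Type := List (List Form × Option Form)

/-- The hypersequent that is denoted by a written one. -/
def Written.denote (w : Written) : Hypersequent :=
  Multiset.ofList (w.map fun c => (Multiset.ofList c.1 ⇛ c.2))

/-- `HFL_e + (lw) + R` is a calculus for the logic `L` (identified with its set of theorems). -/
def IsCalculusFor (R : Set AnalyticRule) (L : Set Form) : Prop :=
  ∀ B : Form, B ∈ L ↔ Derivable R {(0 ⇛ some B)}

end HFL

/-!
# Decidability of hypersequent calculi with left weakening and analytic structural rules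

Derivable hypersequents and underivable hypersequents are both recursively enumerable, so
derivability is decidable by Post's theorem.

Derivations can be listed (`rePred_der`). For underivability, fix a bound `c` on the codes of
formulas. Left weakening, external contraction and external weakening make derivability upward
closed for the order in which `G` is below `H` if every component of `G` weakens to a component of
`H` (`Derivable.of_dominated`). Over finitely many formulas this is a well-quasi-order by Higman's
lemma, so the derivable hypersequents have a basis with multiplicities bounded by some `N`
(`exists_bounded_basis`). Hence derivability over these formulas does not change if hypersequents
are reduced to sets of components and multiplicities of formulas above `N` are identified. So it is
decided in a finite quotient, and an underivable hypersequent is refuted by a finite table that is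
closed under the rules. Conversely such a table refutes everything outside it (`IsModel.sound`), as
the rules have the subformula property (`analytic_of_mem_clausesOf`), and being such a table is a
primitive recursive property (`primrecPred_isModel`). Refutations can thus be searched for, although
no bound on `N` is computed.

To keep these conditions arithmetical, a finite multiset of numbers is coded by the product of the
Fermat numbers with these indices. Fermat numbers are pairwise coprime, so the product determines
the multiset; reduction modulo `(∏ a < c, F a) ^ N` respects sums of multisets and still determines
all multiplicities up to `N` (`exists_moduli`). All rules are written as syntactic clauses
(`Clause`), so that evaluation and primitive recursiveness are treated once for all of them.
-/

namespace HFL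

open Encodable

/-! ### Coding finite multisets by products of Fermat numbers -/

/-- The product of the Fermat numbers with indices in `M`. Fermat numbers are pairwise coprime,
so this product determines `M`. -/
def fermatProd (M : Multiset ℕ) : ℕ := (M.map Nat.fermatNumber).prod

@[simp] theorem fermatProd_zero : fermatProd 0 = 1 := rfl

@[simp] theorem fermatProd_cons (a : ℕ) (M : Multiset ℕ) :
    fermatProd (a ::ₘ M) = Nat.fermatNumber a * fermatProd M := by
  simp [fermatProd]

@[simp] theorem fermatProd_add (M M' : Multiset ℕ) :
    fermatProd (M + M') = fermatProd M * fermatProd M' := by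
  simp [fermatProd]

theorem coprime_fermatProd {a : ℕ} {M : Multiset ℕ} (h : a ∉ M) :
    (Nat.fermatNumber a).Coprime (fermatProd M) := by
  induction M using Multiset.induction with
  | empty => simp
  | cons b M ih =>
    rw [Multiset.mem_cons, not_or] at h
    rw [fermatProd_cons]
    exact Nat.Coprime.mul_right (Nat.coprime_fermatNumber_fermatNumber h.1) (ih h.2)

theorem fermatNumber_pow_dvd_fermatProd {a k : ℕ} {M : Multiset ℕ} :
    Nat.fermatNumber a ^ k ∣ fermatProd M ↔ k ≤ M.count a := by
  have hM : fermatProd M =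
      Nat.fermatNumber a ^ M.count a * fermatProd (M.filter fun b => ¬ a = b) := by
    conv_lhs => rw [← Multiset.filter_add_not (fun b => a = b) M]
    rw [fermatProd_add, Multiset.filter_eq]
    simp [fermatProd]
  have hco : (Nat.fermatNumber a ^ k).Coprime (fermatProd (M.filter fun b => ¬ a = b)) :=
    (coprime_fermatProd (by simp)).pow_left k
  rw [hM, hco.dvd_mul_right,
    Nat.pow_dvd_pow_iff_le_right (by have := Nat.three_le_fermatNumber a; omega)]

theorem fermatProd_injective : Function.Injective fermatProd := by
  intro M M' h
  ext a
  refine le_antisymm ?_ ?_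
  · exact fermatNumber_pow_dvd_fermatProd.1 (h ▸ fermatNumber_pow_dvd_fermatProd.2 le_rfl)
  · exact fermatNumber_pow_dvd_fermatProd.1 (h ▸ fermatNumber_pow_dvd_fermatProd.2 le_rfl)

theorem fermatNumber_dvd_fermatProd {a : ℕ} {M : Multiset ℕ} :
    Nat.fermatNumber a ∣ fermatProd M ↔ a ∈ M := by
  rw [← pow_one (Nat.fermatNumber a), fermatNumber_pow_dvd_fermatProd,
    Multiset.one_le_count_iff_mem]

theorem fermatProd_pos (M : Multiset ℕ) : 0 < fermatProd M := by
  refine Nat.pos_of_ne_zero (Multiset.prod_ne_zero ?_)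
  simp only [Multiset.mem_map, not_exists, not_and]
  intro a _
  have := Nat.three_le_fermatNumber a
  omega

/-! ### Values of multisets, sequents and hypersequents -/

/-- The value of a multiset of formulas modulo `L`; the modulus `0` means no reduction. -/
def mval (L : ℕ) (X : Multiset Form) : ℕ := fermatProd (X.map Form.toCode) % L

/-- The value of a sequent, with antecedent taken modulo `L`. -/
def sval (L : ℕ) (S : Sequent) : ℕ := Nat.pair (mval L S.ant) (encode S.suc)

/-- The value of a hypersequent modulo `L'`, with antecedents taken modulo `L`. -/
def hval (L L' : ℕ) (H : Hypersequent) : ℕ := fermatProd (H.map (sval L)) % L'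

theorem toCode_injective : Function.Injective Form.toCode :=
  Function.LeftInverse.injective Form.ofCode_toCode

theorem mval_zero_injective : Function.Injective (mval 0) := by
  intro X X' h
  simp only [mval, Nat.mod_zero] at h
  exact Multiset.map_injective toCode_injective (fermatProd_injective h)

theorem sval_zero_injective : Function.Injective (sval 0) := by
  rintro ⟨X, P⟩ ⟨X', P'⟩ h
  simp only [sval, Nat.pair_eq_pair] at h
  rw [mval_zero_injective h.1, encode_injective h.2]

theorem hval_zero_injective : Function.Injective (hval 0 0) := by
  intro H H' h
  simp only [hval, Nat.mod_zero] at h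
  exact Multiset.map_injective sval_zero_injective (fermatProd_injective h)

/-- All formulas of the sequent have a code below `c`; the code of a succedent is `0` if it is empty
and that of its formula plus one otherwise. -/
def Sequent.Below (c : ℕ) (S : Sequent) : Prop :=
  (∀ A ∈ S.ant, A.toCode < c) ∧ encode S.suc < c + 1

/-- All formulas of the hypersequent have a code below `c`. -/
def Below (c : ℕ) (H : Hypersequent) : Prop := ∀ S ∈ H, S.Below c

/-! ### The weakening order and its finite bases -/

/-- `S ≼ T`: the sequent `T` arises from `S` by left weakenings. -/
def Sequent.Weaker (S T : Sequent) : Prop := S.ant ≤ T.ant ∧ S.suc = T.suc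

/-- `Dominated G H`: every component of `G` weakens to a component of `H`. -/
def Dominated (G H : Hypersequent) : Prop := ∀ S ∈ G, ∃ T ∈ H, S.Weaker T

theorem Derivable.lw_add {R : Set AnalyticRule} {H : Hypersequent} {X : Multiset Form}
    {P : Option Form} (h : Derivable R ((X ⇛ P) ::ₘ H)) (Y : Multiset Form) :
    Derivable R ((Y + X ⇛ P) ::ₘ H) := by
  induction Y using Multiset.induction with
  | empty => simpa using h
  | cons A Y ih => rw [Multiset.cons_add]; exact .lw _ _ _ _ ih

theorem Derivable.ew_add {R : Set AnalyticRule} {H : Hypersequent} (h : Derivable R H)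
    (G : Hypersequent) : Derivable R (G + H) := by
  induction G using Multiset.induction with
  | empty => simpa using h
  | cons S G ih => rw [Multiset.cons_add]; exact .ew _ _ _ ih

/-- Derivability is upward closed: weaken each component internally, merge equal components by
external contraction, and add the missing ones by external weakening. -/
theorem Derivable.of_dominated {R : Set AnalyticRule} {H H' : Hypersequent}
    (h : Derivable R H) (hd : Dominated H H') : Derivable R H' := by
  -- the components of `H` are absorbed into `H'` one at a time; `G` holds those already weakened
  have key : ∀ (H G : Hypersequent), Dominated H H' → Derivable R (H + G) →
      Derivable R (H' + G) := by
    intro H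
    induction H using Multiset.induction with
    | empty => intro G _ h; exact Derivable.ew_add (by simpa using h) _
    | cons S H ih =>
      intro G hd h
      obtain ⟨T, hT, hle, hs⟩ := hd S (Multiset.mem_cons_self _ _)
      obtain ⟨K, rfl⟩ := Multiset.exists_cons_of_mem hT
      obtain ⟨Y, hY⟩ := Multiset.le_iff_exists_add.1 hle
      have h1 : Derivable R (T ::ₘ (H + G)) := by
        have := Derivable.lw_add (X := S.ant) (P := S.suc) (by rwa [Multiset.cons_add] at h) Y
        rwa [add_comm, ← hY, hs] at this
      have h2 := ih (T ::ₘ G) (fun S' hS' => hd S' (Multiset.mem_cons_of_mem hS'))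
        (by rwa [Multiset.add_cons])
      rw [Multiset.add_cons, Multiset.cons_add] at h2
      rw [Multiset.cons_add]
      exact .ec _ _ _ h2
  simpa using key H 0 hd (by simpa using h)

instance sublistForall₂_isPreorder {α : Type*} (r : α → α → Prop) [IsPreorder α r] :
    IsPreorder (List α) (List.SublistForall₂ r) where

/-- The weakening order on written sequents. -/
def CompLE (p q : List Form × Option Form) : Prop :=
  List.SublistForall₂ (· = ·) p.1 q.1 ∧ p.2 = q.2

instance : IsPreorder (List Form × Option Form) CompLE where
  refl _ := ⟨refl _, rfl⟩
  trans _ _ _ h h' := ⟨_root_.trans h.1 h'.1, h.2.trans h'.2⟩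

/-- Higman's lemma, applied to the antecedents (lists over a finite alphabet) and then to the
hypersequents (lists of sequents). -/
theorem written_partiallyWellOrdered (c : ℕ) :
    {w : Written | ∀ p ∈ w, (∀ A ∈ p.1, A.toCode < c) ∧
      encode p.2 < c + 1}.PartiallyWellOrderedOn (List.SublistForall₂ CompLE) := by
  have hF : {A : Form | A.toCode < c}.Finite :=
    Set.Finite.preimage toCode_injective.injOn (Set.finite_lt_nat c)
  have hP : {P : Option Form | encode P < c + 1}.Finite :=
    Set.Finite.preimage encode_injective.injOn (Set.finite_lt_nat (c + 1))
  have h1 := Set.PartiallyWellOrderedOn.partiallyWellOrderedOn_sublistForall₂ (· = ·)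
    (hF.partiallyWellOrderedOn (r := (· = ·)))
  have h2 := h1.prod (hP.partiallyWellOrderedOn (r := (· = ·)))
  exact Set.PartiallyWellOrderedOn.partiallyWellOrderedOn_sublistForall₂ CompLE h2

theorem dominated_of_sublistForall₂ {w w' : Written} (h : List.SublistForall₂ CompLE w w') :
    Dominated w.denote w'.denote := by
  induction h with
  | nil => intro S hS; simp [Written.denote] at hS
  | @cons p q l l' hpq _ ih =>
    intro S hS
    simp only [Written.denote, List.map_cons, ← Multiset.cons_coe, Multiset.mem_cons] at hS ⊢
    rcases hS with rfl | hS
    · refine ⟨_, Or.inl rfl, ?_, hpq.2⟩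
      obtain ⟨l, hl, hs⟩ := List.sublistForall₂_iff.1 hpq.1
      rw [List.forall₂_eq_eq_eq] at hl
      subst hl
      exact Multiset.coe_le.2 hs.subperm
    · obtain ⟨T, hT, hST⟩ := ih S hS
      exact ⟨T, Or.inr hT, hST⟩
  | cons_right _ ih =>
    intro S hS
    obtain ⟨T, hT, hST⟩ := ih S hS
    refine ⟨T, ?_, hST⟩
    simp only [Written.denote, List.map_cons, ← Multiset.cons_coe, Multiset.mem_cons] at hT ⊢
    exact Or.inr hT

theorem exists_written (H : Hypersequent) : ∃ w : Written, w.denote = H := by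
  refine ⟨H.toList.map fun S => (S.ant.toList, S.suc), ?_⟩
  simp [Written.denote, Function.comp_def]

theorem below_denote {c : ℕ} {w : Written} :
    Below c w.denote ↔ ∀ p ∈ w, (∀ A ∈ p.1, A.toCode < c) ∧ encode p.2 < c + 1 := by
  simp only [Below, Written.denote, Multiset.mem_coe, List.forall_mem_map]
  rfl

theorem exists_multiplicity_bound (H : Hypersequent) :
    ∃ N : ℕ, ∀ S ∈ H, ∀ A, S.ant.count A ≤ N := by
  induction H using Multiset.induction with
  | empty => simp
  | cons T H ih =>
    obtain ⟨N, hN⟩ := ih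
    refine ⟨max N T.ant.card, fun S hS A => ?_⟩
    rcases Multiset.mem_cons.1 hS with rfl | hS
    · exact (Multiset.count_le_card _ _).trans (le_max_right _ _)
    · exact (hN S hS A).trans (le_max_left _ _)

/-- By the well-quasi-ordering, any set of hypersequents over finitely many formulas has a basis
with respect to domination whose multiplicities are bounded. -/
theorem exists_bounded_basis (p : Hypersequent → Prop) (c : ℕ) :
    ∃ N : ℕ, ∀ H, Below c H → p H →
      ∃ G, p G ∧ Dominated G H ∧ ∀ S ∈ G, ∀ A, S.ant.count A ≤ N := by
  -- Otherwise there is a bad `H N` for each `N`. In a monotone subsequence, the first term lies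
  -- below a later one with an index above the multiplicities of the first.
  by_contra! hcon
  choose H hH hp hbad using hcon
  choose w hw using fun N => exists_written (H N)
  obtain ⟨g, hg⟩ := (written_partiallyWellOrdered c).exists_monotone_subseq (f := w) (by
    intro N
    have := hH N
    rw [← hw N, below_denote] at this
    exact this)
  obtain ⟨N, hN⟩ := exists_multiplicity_bound (H (g 0))
  have hdom := dominated_of_sublistForall₂ (hg 0 N (Nat.zero_le _))
  rw [hw, hw] at hdom
  obtain ⟨S, hS, A, hA⟩ := hbad (g N) (H (g 0)) (hp _) hdom
  have := hN S hS A
  have := g.strictMono.le_apply (x := N)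
  omega

/-- For each bound on the formulas there are moduli for which the value of a hypersequent over
these formulas decides its derivability: the value modulo `L'` determines the set of values of
components, and the value of an antecedent modulo `L` determines its multiplicities up to `N`. -/
theorem exists_moduli (R : Set AnalyticRule) (c : ℕ) :
    ∃ L L' : ℕ, 0 < L ∧ 0 < L' ∧ ∀ H H', Below c H → Below c H' → hval L L' H = hval L L' H' →
      Derivable R H → Derivable R H' := by
  obtain ⟨N, hN⟩ := exists_bounded_basis (Derivable R) c
  set L := fermatProd (Multiset.range c) ^ N with hL
  have hLpos : 0 < L := Nat.pow_pos (fermatProd_pos _)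
  set Y := Nat.pair L (c + 1) with hY
  refine ⟨L, fermatProd (Multiset.range Y), hLpos, fermatProd_pos _, ?_⟩
  intro H H' hH hH' hv hd
  obtain ⟨G, hG, hGH, hmul⟩ := hN H hH hd
  refine hG.of_dominated fun S hS => ?_
  obtain ⟨T, hT, hle, hsuc⟩ := hGH S hS
  -- the value of the component `T` of `H` also occurs in `H'`
  have hlt : sval L T < Y :=
    (Nat.pair_lt_pair_left _ (Nat.mod_lt _ hLpos)).trans (Nat.pair_lt_pair_right _ (hH T hT).2)
  have hdvd : Nat.fermatNumber (sval L T) ∣ fermatProd (Multiset.range Y) :=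
    fermatNumber_dvd_fermatProd.2 (Multiset.mem_range.2 hlt)
  have h1 : Nat.fermatNumber (sval L T) ∣ hval L (fermatProd (Multiset.range Y)) H :=
    (Nat.dvd_mod_iff hdvd).2
      (fermatNumber_dvd_fermatProd.2 (Multiset.mem_map_of_mem _ hT))
  rw [hv, hval, Nat.dvd_mod_iff hdvd, fermatNumber_dvd_fermatProd, Multiset.mem_map] at h1
  obtain ⟨T', hT', hTT'⟩ := h1
  simp only [sval, Nat.pair_eq_pair] at hTT'
  refine ⟨T', hT', ?_, hsuc.trans (encode_injective hTT'.2).symm⟩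
  rw [Multiset.le_iff_count]
  intro A
  by_cases hA : A ∈ S.ant
  swap
  · simp [Multiset.count_eq_zero_of_notMem hA]
  have hAc : A.toCode < c := (hH T hT).1 A (Multiset.mem_of_le hle hA)
  have hpow : Nat.fermatNumber A.toCode ^ S.ant.count A ∣ L :=
    (pow_dvd_pow _ (hmul S hS A)).trans
      (pow_dvd_pow_of_dvd (fermatNumber_dvd_fermatProd.2 (Multiset.mem_range.2 hAc)) N)
  have h2 : Nat.fermatNumber A.toCode ^ S.ant.count A ∣ mval L T.ant := by
    rw [mval, Nat.dvd_mod_iff hpow, fermatNumber_pow_dvd_fermatProd,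
      Multiset.count_map_eq_count' _ _ toCode_injective]
    exact Multiset.le_iff_count.1 hle A
  rwa [← hTT'.1, mval, Nat.dvd_mod_iff hpow, fermatNumber_pow_dvd_fermatProd,
    Multiset.count_map_eq_count' _ _ toCode_injective] at h2

/-! ### Rules as syntactic clauses -/

/-- A formula pattern over the variables `V`. -/
inductive FormTerm (V : Type) : Type
  | var (v : V) : FormTerm V
  | top : FormTerm V
  | bot : FormTerm V
  | one : FormTerm V
  | zero : FormTerm V
  | conj (u v : V) : FormTerm V
  | disj (u v : V) : FormTerm V
  | fusion (u v : V) : FormTerm V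
  | imp (u v : V) : FormTerm V

/-- A succedent pattern: empty, a formula pattern, or a succedent-variable. -/
inductive SucTerm (V : Type) : Type
  | none : SucTerm V
  | some (t : FormTerm V) : SucTerm V
  | var (v : V) : SucTerm V

/-- A sequent pattern: formula patterns and multiset-variables in the antecedent, and a succedent
pattern. -/
structure SeqTerm (V : Type) : Type where
  fms : List (FormTerm V)
  mvs : List V
  suc : SucTerm V

/-- A rule given by patterns for the active components of its premises and of its conclusion; the
side hypersequent is left implicit. The same index type `V` serves for formula-, multiset- and
succedent-variables. -/
structure Clause : Type 1 where
  V : Type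
  fin : Finite V
  prems : List (List (SeqTerm V))
  concl : List (SeqTerm V)

/-- An instantiation of the formula-, multiset- and succedent-variables. -/
structure Inst (V : Type) : Type where
  A : V → Form
  X : V → Multiset Form
  P : V → Option Form

namespace FormTerm

/-- The formula denoted by a pattern. -/
def eval {V : Type} (A : V → Form) : FormTerm V → Form
  | var v => A v
  | top => .top
  | bot => .bot
  | one => .one
  | zero => .zero
  | conj u v => .conj (A u) (A v)
  | disj u v => .disj (A u) (A v)
  | fusion u v => .fusion (A u) (A v)
  | imp u v => .imp (A u) (A v)

end FormTerm

/-- The succedent denoted by a pattern. -/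
def SucTerm.eval {V : Type} (ρ : Inst V) : SucTerm V → Option Form
  | none => .none
  | some t => .some (t.eval ρ.A)
  | var v => ρ.P v

/-- The sequent denoted by a pattern. -/
def SeqTerm.eval {V : Type} (ρ : Inst V) (s : SeqTerm V) : Sequent :=
  ⟨(s.fms.map (FormTerm.eval ρ.A) : Multiset Form) + (s.mvs.map ρ.X).sum, s.suc.eval ρ⟩

/-- The hypersequent denoted by a list of patterns next to a side hypersequent. -/
def hypEval {V : Type} (ρ : Inst V) (H : Hypersequent) (l : List (SeqTerm V)) : Hypersequent :=
  (l.map (SeqTerm.eval ρ) : Multiset Sequent) + H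

/-- Derivability by a list of clauses. -/
inductive Der (C : List Clause) : Hypersequent → Prop
  | step (σ : Clause) (hσ : σ ∈ C) (ρ : Inst σ.V) (H : Hypersequent) :
      (∀ l ∈ σ.prems, Der C (hypEval ρ H l)) → Der C (hypEval ρ H σ.concl)

/-- The subformula property of a clause: bounds on the codes of the formulas in the conclusion
bound those in the premises. -/
def Clause.Analytic (σ : Clause) : Prop :=
  ∀ (c : ℕ) (ρ : Inst σ.V) (H : Hypersequent), Below c (hypEval ρ H σ.concl) →
    ∀ l ∈ σ.prems, Below c (hypEval ρ H l)

open FormTerm in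
/-- The rules of `HFL_e + (lw)`, each as the list of its premises and its conclusion; all of them
can be written with two variables of each sort. -/
def logicalRules : List (List (List (SeqTerm (Fin 2))) × List (SeqTerm (Fin 2))) :=
  [([], [⟨[var 0], [], .some (var 0)⟩]),
   ([], [⟨[bot], [0], .var 0⟩]),
   ([], [⟨[], [0], .some top⟩]),
   ([], [⟨[zero], [], .none⟩]),
   ([], [⟨[], [], .some one⟩]),
   ([[⟨[], [0], .var 0⟩]], [⟨[one], [0], .var 0⟩]),
   ([[⟨[], [0], .none⟩]], [⟨[], [0], .some zero⟩]),
   ([[⟨[], [0], .var 0⟩, ⟨[], [0], .var 0⟩]], [⟨[], [0], .var 0⟩]),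
   ([[]], [⟨[], [0], .var 0⟩]),
   ([[⟨[var 0, var 1], [0], .var 0⟩]], [⟨[fusion 0 1], [0], .var 0⟩]),
   ([[⟨[], [0], .some (var 0)⟩], [⟨[], [1], .some (var 1)⟩]],
     [⟨[], [0, 1], .some (fusion 0 1)⟩]),
   ([[⟨[var 0], [0], .var 0⟩], [⟨[var 1], [0], .var 0⟩]], [⟨[disj 0 1], [0], .var 0⟩]),
   ([[⟨[], [0], .some (var 0)⟩]], [⟨[], [0], .some (disj 0 1)⟩]),
   ([[⟨[], [0], .some (var 1)⟩]], [⟨[], [0], .some (disj 0 1)⟩]),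
   ([[⟨[var 0], [0], .var 0⟩]], [⟨[conj 0 1], [0], .var 0⟩]),
   ([[⟨[var 1], [0], .var 0⟩]], [⟨[conj 0 1], [0], .var 0⟩]),
   ([[⟨[], [0], .some (var 0)⟩], [⟨[], [0], .some (var 1)⟩]],
     [⟨[], [0], .some (conj 0 1)⟩]),
   ([[⟨[], [0], .some (var 0)⟩], [⟨[var 1], [1], .var 0⟩]], [⟨[imp 0 1], [0, 1], .var 0⟩]),
   ([[⟨[var 0], [0], .some (var 1)⟩]], [⟨[], [0], .some (imp 0 1)⟩]),
   ([[⟨[], [0], .var 0⟩]], [⟨[var 0], [0], .var 0⟩])]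

/-- The clause of a rule of `logicalRules`. -/
def logicalClause (p : List (List (SeqTerm (Fin 2))) × List (SeqTerm (Fin 2))) : Clause :=
  ⟨Fin 2, inferInstance, p.1, p.2⟩

/-- The multiset-variables of a schema form a finite type. -/
theorem finite_mvar {nI nJ : ℕ} (s : Fin nI → ℕ) (t : Fin nJ → ℕ) : Finite (MVar nI nJ s t) := by
  let f : Fin nI ⊕ (Σ i, Fin (s i)) ⊕ (Σ j, Fin (t j)) → MVar nI nJ s t :=
    Sum.elim .Y (Sum.elim (fun x => .X x.1 x.2) (fun x => .Z x.1 x.2))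
  refine Finite.of_surjective f ?_
  rintro (i | ⟨i, k⟩ | ⟨j, k⟩)
  · exact ⟨.inl i, rfl⟩
  · exact ⟨.inr (.inl ⟨i, k⟩), rfl⟩
  · exact ⟨.inr (.inr ⟨j, k⟩), rfl⟩

/-- An analytic structural rule schema as a clause; the succedent-variable `Π i` is indexed by the
multiset-variable `Y i`. -/
def AnalyticRule.toClause (r : AnalyticRule) : Clause where
  V := r.Var
  fin := finite_mvar _ _
  prems := ((List.finRange r.nI).flatMap fun i =>
    (r.premI i).map fun l => [⟨[], MVar.Y i :: l, .var (MVar.Y i)⟩]) ++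
    r.premL.map fun l => [⟨[], l, .none⟩]
  concl := ((List.finRange r.nI).map fun i =>
    ⟨[], MVar.Y i :: (List.finRange (r.s i)).map (MVar.X i), .var (MVar.Y i)⟩) ++
    (List.finRange r.nJ).map fun j => ⟨[], (List.finRange (r.t j)).map (MVar.Z j), .none⟩

theorem AnalyticRule.hypEval_concl (r : AnalyticRule) (ρ : Inst r.Var) (H : Hypersequent) :
    hypEval (V := r.toClause.V) ρ H r.toClause.concl =
      r.conclusion H ρ.X fun i => ρ.P (MVar.Y i) := by
  simp only [hypEval, toClause, conclusion, Fin.univ_val_map, List.map_append, List.map_map,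
    ← Multiset.coe_add, List.ofFn_eq_map]
  rw [add_comm, add_assoc]
  congr 3
  · refine List.map_congr_left fun i _ => ?_
    simp [SeqTerm.eval, SucTerm.eval, Function.comp_def, Fin.sum_univ_def]
  · refine List.map_congr_left fun i _ => ?_
    simp [SeqTerm.eval, SucTerm.eval, Function.comp_def, Fin.sum_univ_def]

theorem AnalyticRule.hypEval_prems (r : AnalyticRule) (ρ : Inst r.Var) (H : Hypersequent) :
    r.toClause.prems.map (hypEval (V := r.toClause.V) ρ H) =
      r.premises H ρ.X fun i => ρ.P (MVar.Y i) := by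
  simp [hypEval, toClause, premises, List.map_flatMap, Function.comp_def, SeqTerm.eval,
    SucTerm.eval]

/-- A finite list of clauses for the whole calculus. -/
def clausesOf (l : List AnalyticRule) : List Clause :=
  logicalRules.map logicalClause ++ l.map AnalyticRule.toClause

theorem Der.of_derivable {l : List AnalyticRule} {H : Hypersequent}
    (h : Derivable {r | r ∈ l} H) : Der (clausesOf l) H := by
  -- the number `n` is the position of a rule in `logicalRules`
  have key : ∀ (A B : Form) (X Y : Multiset Form) (P : Option Form) G,
      ∀ n (hn : n < logicalRules.length),
      (∀ t ∈ logicalRules[n].1, Der (clausesOf l) (hypEval ⟨![A, B], ![X, Y], ![P, P]⟩ G t)) →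
        Der (clausesOf l) (hypEval ⟨![A, B], ![X, Y], ![P, P]⟩ G logicalRules[n].2) :=
    fun A B X Y P G n hn h => .step (logicalClause logicalRules[n])
      (List.mem_append_left _ (List.mem_map_of_mem (List.getElem_mem hn))) _ G h
  simp only [hypEval] at key
  induction h with
  | ext r hr H m p _ ih =>
    have := Der.step (C := clausesOf l) r.toClause
      (List.mem_append_right _ (List.mem_map_of_mem hr))
      (⟨fun _ => .top, m, fun | .Y i => p i | _ => none⟩ : Inst r.Var) H
    rw [show hypEval _ H _ = _ from AnalyticRule.hypEval_concl r _ H] at this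
    refine this fun t ht => ih _ ?_
    exact (AnalyticRule.hypEval_prems r
      (⟨fun _ => .top, m, fun | .Y i => p i | _ => none⟩ : Inst r.Var) H) ▸ List.mem_map_of_mem ht
  | id H A =>
    simpa [logicalRules, SeqTerm.eval, FormTerm.eval, SucTerm.eval] using
      key A A 0 0 none H 0 (by decide)
  | botL H X P =>
    simpa [logicalRules, SeqTerm.eval, FormTerm.eval, SucTerm.eval] using
      key .top .top X 0 P H 1 (by decide)
  | topR H X =>
    simpa [logicalRules, SeqTerm.eval, FormTerm.eval, SucTerm.eval] using
      key .top .top X 0 none H 2 (by decide)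
  | zeroL H =>
    simpa [logicalRules, SeqTerm.eval, FormTerm.eval, SucTerm.eval] using
      key .top .top 0 0 none H 3 (by decide)
  | oneR H =>
    simpa [logicalRules, SeqTerm.eval, FormTerm.eval, SucTerm.eval] using
      key .top .top 0 0 none H 4 (by decide)
  | oneL H X P _ ih =>
    simpa [logicalRules, SeqTerm.eval, FormTerm.eval, SucTerm.eval, ih] using
      key .top .top X 0 P H 5 (by decide)
  | zeroR H X _ ih =>
    simpa [logicalRules, SeqTerm.eval, FormTerm.eval, SucTerm.eval, ih] using
      key .top .top X 0 none H 6 (by decide)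
  | ec H X P _ ih =>
    simpa [logicalRules, SeqTerm.eval, FormTerm.eval, SucTerm.eval, ← Multiset.cons_coe, ih] using
      key .top .top X 0 P H 7 (by decide)
  | ew H X P _ ih =>
    simpa [logicalRules, SeqTerm.eval, FormTerm.eval, SucTerm.eval, ih] using
      key .top .top X 0 P H 8 (by decide)
  | fusionL H X A B P _ ih =>
    simpa [logicalRules, SeqTerm.eval, FormTerm.eval, SucTerm.eval, ← Multiset.cons_coe, ih] using
      key A B X 0 P H 9 (by decide)
  | fusionR H X Y A B _ _ ih1 ih2 =>
    simpa [logicalRules, SeqTerm.eval, FormTerm.eval, SucTerm.eval, ih1, ih2] using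
      key A B X Y none H 10 (by decide)
  | disjL H X A B P _ _ ih1 ih2 =>
    simpa [logicalRules, SeqTerm.eval, FormTerm.eval, SucTerm.eval, ih1, ih2] using
      key A B X 0 P H 11 (by decide)
  | disjR1 H X A B _ ih =>
    simpa [logicalRules, SeqTerm.eval, FormTerm.eval, SucTerm.eval, ih] using
      key A B X 0 none H 12 (by decide)
  | disjR2 H X A B _ ih =>
    simpa [logicalRules, SeqTerm.eval, FormTerm.eval, SucTerm.eval, ih] using
      key A B X 0 none H 13 (by decide)
  | conjL1 H X A B P _ ih =>
    simpa [logicalRules, SeqTerm.eval, FormTerm.eval, SucTerm.eval, ih] using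
      key A B X 0 P H 14 (by decide)
  | conjL2 H X A B P _ ih =>
    simpa [logicalRules, SeqTerm.eval, FormTerm.eval, SucTerm.eval, ih] using
      key A B X 0 P H 15 (by decide)
  | conjR H X A B _ _ ih1 ih2 =>
    simpa [logicalRules, SeqTerm.eval, FormTerm.eval, SucTerm.eval, ih1, ih2] using
      key A B X 0 none H 16 (by decide)
  | impL H X Y A B P _ _ ih1 ih2 =>
    simpa [logicalRules, SeqTerm.eval, FormTerm.eval, SucTerm.eval, ih1, ih2] using
      key A B X Y P H 17 (by decide)
  | impR H X A B _ ih =>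
    simpa [logicalRules, SeqTerm.eval, FormTerm.eval, SucTerm.eval, ih] using
      key A B X 0 none H 18 (by decide)
  | lw H X A P _ ih =>
    simpa [logicalRules, SeqTerm.eval, FormTerm.eval, SucTerm.eval, ih] using
      key A A X 0 P H 19 (by decide)

theorem Der.derivable {l : List AnalyticRule} {H : Hypersequent}
    (h : Der (clausesOf l) H) : Derivable {r | r ∈ l} H := by
  induction h with
  | step σ hσ ρ H _ ih =>
    rcases List.mem_append.1 hσ with hσ | hσ
    · obtain ⟨p, hp, rfl⟩ := List.mem_map.1 hσ
      change Inst (Fin 2) at ρ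
      change ∀ t ∈ p.1, Derivable {r | r ∈ l} (hypEval ρ H t) at ih
      change Derivable {r | r ∈ l} (hypEval ρ H p.2)
      simp only [logicalRules, List.mem_cons, List.not_mem_nil, or_false] at hp
      rcases hp with rfl | rfl | rfl | rfl | rfl | rfl | rfl | rfl | rfl | rfl | rfl | rfl | rfl |
        rfl | rfl | rfl | rfl | rfl | rfl | rfl <;>
      simp [hypEval, SeqTerm.eval, FormTerm.eval, SucTerm.eval, ← Multiset.cons_coe]
        at ih ⊢
      · exact .id _ _
      · exact .botL _ _ _
      · exact .topR _ _
      · exact .zeroL _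
      · exact .oneR _
      · exact .oneL _ _ _ ih
      · exact .zeroR _ _ ih
      · exact .ec _ _ _ ih
      · exact .ew _ _ _ ih
      · exact .fusionL _ _ _ _ _ ih
      · exact .fusionR _ _ _ _ _ ih.1 ih.2
      · exact .disjL _ _ _ _ _ ih.1 ih.2
      · exact .disjR1 _ _ _ _ ih
      · exact .disjR2 _ _ _ _ ih
      · exact .conjL1 _ _ _ _ _ ih
      · exact .conjL2 _ _ _ _ _ ih
      · exact .conjR _ _ _ _ ih.1 ih.2
      · exact .impL _ _ _ _ _ _ ih.1 ih.2
      · exact .impR _ _ _ _ ih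
      · exact .lw _ _ _ _ ih
    · obtain ⟨r, hr, rfl⟩ := List.mem_map.1 hσ
      rw [show hypEval ρ H _ = _ from AnalyticRule.hypEval_concl r ρ H]
      refine .ext r hr _ _ _ fun g hg => ?_
      rw [← AnalyticRule.hypEval_prems r ρ H] at hg
      obtain ⟨t, ht, rfl⟩ := List.mem_map.1 hg
      exact ih t ht

theorem der_iff_derivable {l : List AnalyticRule} {H : Hypersequent} :
    Der (clausesOf l) H ↔ Derivable {r | r ∈ l} H :=
  ⟨Der.derivable, Der.of_derivable⟩

theorem below_eval {V : Type} {c : ℕ} {ρ : Inst V} {s : SeqTerm V} :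
    (s.eval ρ).Below c ↔ (∀ t ∈ s.fms, (t.eval ρ.A).toCode < c) ∧
      (∀ v ∈ s.mvs, ∀ A ∈ ρ.X v, A.toCode < c) ∧ encode (s.suc.eval ρ) < c + 1 := by
  simp only [Sequent.Below, SeqTerm.eval, Multiset.mem_add, Multiset.mem_coe, ← and_assoc]
  refine and_congr_left fun _ => ?_
  have hsum : ∀ (A : Form) (l : List V), A ∈ (l.map ρ.X).sum ↔ ∃ v ∈ l, A ∈ ρ.X v := by
    intro A l
    induction l <;> simp_all
  simp only [hsum, or_imp, forall_and, List.mem_map, forall_exists_index, and_imp,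
    forall_apply_eq_imp_iff₂]
  exact and_congr_right fun _ => ⟨fun h v hv A hA => h A v hv hA, fun h A v hv hA => h v hv A hA⟩

theorem below_hypEval {V : Type} {c : ℕ} {ρ : Inst V} {H : Hypersequent} {l : List (SeqTerm V)} :
    Below c (hypEval ρ H l) ↔ (∀ s ∈ l, (s.eval ρ).Below c) ∧ Below c H := by
  simp only [Below, hypEval, Multiset.mem_add, Multiset.mem_coe, or_imp, forall_and,
    List.forall_mem_map]

theorem encode_form (A : Form) : encode A = A.toCode := rfl

/-- In a schema every variable occurs in the conclusion; in the other rules the formulas of the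
premises are subformulas of those of the conclusion, and subformulas have smaller codes. -/
theorem analytic_of_mem_clausesOf {l : List AnalyticRule} {σ : Clause} (hσ : σ ∈ clausesOf l) :
    σ.Analytic := by
  intro c ρ H hc
  rcases List.mem_append.1 hσ with hσ | hσ
  · obtain ⟨p, hp, rfl⟩ := List.mem_map.1 hσ
    change Inst (Fin 2) at ρ
    change Below c (hypEval ρ H p.2) at hc
    change ∀ t ∈ p.1, Below c (hypEval ρ H t)
    have h1 := Nat.left_le_pair (ρ.A 0).toCode (ρ.A 1).toCode
    have h2 := Nat.right_le_pair (ρ.A 0).toCode (ρ.A 1).toCode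
    simp only [logicalRules, List.mem_cons, List.not_mem_nil, or_false] at hp
    rcases hp with rfl | rfl | rfl | rfl | rfl | rfl | rfl | rfl | rfl | rfl | rfl | rfl | rfl |
      rfl | rfl | rfl | rfl | rfl | rfl | rfl <;>
    simp [below_hypEval, below_eval, FormTerm.eval, SucTerm.eval, encode_form, Form.toCode]
      at hc ⊢ <;> grind
  · obtain ⟨r, hr, rfl⟩ := List.mem_map.1 hσ
    intro t ht
    rw [below_hypEval] at hc ⊢
    refine ⟨?_, hc.2⟩
    have hY : ∀ i, (∀ A ∈ ρ.X (MVar.Y i), A.toCode < c) ∧ encode (ρ.P (MVar.Y i)) < c + 1 := by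
      intro i
      have := below_eval.1 (hc.1 ⟨[], MVar.Y i :: (List.finRange (r.s i)).map (MVar.X i),
        .var (MVar.Y i)⟩ (List.mem_append_left _ (List.mem_map_of_mem (List.mem_finRange i))))
      exact ⟨this.2.1 _ (List.mem_cons_self ..), this.2.2⟩
    have hX : ∀ v, ∀ A ∈ ρ.X v, A.toCode < c := by
      rintro (i | ⟨i, k⟩ | ⟨j, k⟩)
      · exact (hY i).1
      · have := below_eval.1 (hc.1 ⟨[], MVar.Y i :: (List.finRange (r.s i)).map (MVar.X i),
          .var (MVar.Y i)⟩ (List.mem_append_left _ (List.mem_map_of_mem (List.mem_finRange i))))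
        exact this.2.1 _ (List.mem_cons_of_mem _ (List.mem_map_of_mem (List.mem_finRange k)))
      · have := below_eval.1 (hc.1 ⟨[], (List.finRange (r.t j)).map (MVar.Z j), .none⟩
          (List.mem_append_right _ (List.mem_map_of_mem (List.mem_finRange j))))
        exact this.2.1 _ (List.mem_map_of_mem (List.mem_finRange k))
    rcases List.mem_append.1 ht with ht | ht
    · obtain ⟨i, -, ht⟩ := List.mem_flatMap.1 ht
      obtain ⟨m, -, rfl⟩ := List.mem_map.1 ht
      intro s hs
      obtain rfl := List.mem_singleton.1 hs
      exact below_eval.2 ⟨List.forall_mem_nil _, fun v _ => hX v, (hY i).2⟩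
    · obtain ⟨m, -, rfl⟩ := List.mem_map.1 ht
      intro s hs
      obtain rfl := List.mem_singleton.1 hs
      exact below_eval.2 ⟨List.forall_mem_nil _, fun v _ => hX v, by simp [SucTerm.eval]⟩

/-! ### Evaluation of clauses on values -/

/-- Numerical values of the formula-, multiset- and succedent-variables. -/
structure Vals (V : Type) : Type where
  a : V → ℕ
  x : V → ℕ
  p : V → ℕ

/-- The code of the formula denoted by a pattern, from the codes of its variables. -/
def FormTerm.code {V : Type} (a : V → ℕ) : FormTerm V → ℕ
  | var v => a v
  | top => 0
  | bot => 1
  | one => 2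
  | zero => 3
  | conj u v => 5 * Nat.pair (a u) (a v) + 5
  | disj u v => 5 * Nat.pair (a u) (a v) + 6
  | fusion u v => 5 * Nat.pair (a u) (a v) + 7
  | imp u v => 5 * Nat.pair (a u) (a v) + 8

/-- The code of the succedent denoted by a pattern. -/
def SucTerm.code {V : Type} (ν : Vals V) : SucTerm V → ℕ
  | none => 0
  | some t => t.code ν.a + 1
  | var v => ν.p v

/-- The value of the sequent denoted by a pattern. -/
def SeqTerm.value {V : Type} (L : ℕ) (ν : Vals V) (s : SeqTerm V) : ℕ :=
  Nat.pair (((s.fms.map fun t => Nat.fermatNumber (t.code ν.a)).prod *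
    (s.mvs.map fun v => ν.x v).prod) % L) (s.suc.code ν)

/-- The value of the hypersequent denoted by a list of patterns next to a side hypersequent of
value `k`. -/
def hypValue {V : Type} (L L' : ℕ) (ν : Vals V) (k : ℕ) (l : List (SeqTerm V)) : ℕ :=
  ((l.map fun s => Nat.fermatNumber (s.value L ν)).prod * k) % L'

/-- The values of an instantiation. -/
def Inst.vals {V : Type} (L : ℕ) (ρ : Inst V) : Vals V :=
  ⟨fun v => (ρ.A v).toCode, fun v => mval L (ρ.X v), fun v => encode (ρ.P v)⟩

theorem FormTerm.toCode_eval {V : Type} (A : V → Form) (t : FormTerm V) :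
    (t.eval A).toCode = t.code fun v => (A v).toCode := by
  cases t <;> rfl

theorem SucTerm.encode_eval {V : Type} (L : ℕ) (ρ : Inst V) (s : SucTerm V) :
    encode (s.eval ρ) = s.code (ρ.vals L) := by
  cases s with
  | none => rfl
  | some t =>
    simp only [eval, code, encode_some, encode_form, FormTerm.toCode_eval, Nat.succ_eq_add_one]
    rfl
  | var v => rfl

theorem mval_cons (L : ℕ) (A : Form) (X : Multiset Form) :
    mval L (A ::ₘ X) = (Nat.fermatNumber A.toCode * mval L X) % L := by
  simp [mval]

theorem hval_cons (L L' : ℕ) (S : Sequent) (H : Hypersequent) :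
    hval L L' (S ::ₘ H) = (Nat.fermatNumber (sval L S) * hval L L' H) % L' := by
  simp [hval]

theorem mval_sum {V : Type} (L : ℕ) (X : V → Multiset Form) (l : List V) :
    mval L (l.map X).sum = (l.map fun v => mval L (X v)).prod % L := by
  induction l with
  | nil => simp [mval]
  | cons v l ih =>
    rw [List.map_cons, List.sum_cons, List.map_cons, List.prod_cons, Nat.mul_mod, ← ih]
    simp [mval, Nat.mul_mod]

theorem sval_eval {V : Type} (L : ℕ) (ρ : Inst V) (s : SeqTerm V) :
    sval L (s.eval ρ) = s.value L (ρ.vals L) := by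
  rw [sval, SeqTerm.value, ← SucTerm.encode_eval]
  congr 1
  rw [Nat.mul_mod]
  change _ = (_ % L * ((s.mvs.map fun v => mval L (ρ.X v)).prod % L)) % L
  rw [← mval_sum]
  simp [SeqTerm.eval, mval, fermatProd, Nat.mul_mod, Function.comp_def, FormTerm.toCode_eval,
    Inst.vals]

theorem hval_hypEval {V : Type} (L L' : ℕ) (ρ : Inst V) (H : Hypersequent)
    (l : List (SeqTerm V)) :
    hval L L' (hypEval ρ H l) = hypValue L L' (ρ.vals L) (hval L L' H) l := by
  simp [hval, hypEval, hypValue, fermatProd, Nat.mul_mod, Function.comp_def, sval_eval]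

/-! ### Primitive recursiveness of the values -/

section Primrec

open Primrec

theorem primrec_fermatNumber : Primrec Nat.fermatNumber :=
  have hpow : Primrec₂ ((· ^ ·) : ℕ → ℕ → ℕ) := Primrec₂.unpaired'.1 Nat.Primrec.pow
  succ.comp (hpow.comp (const 2) (hpow.comp (const 2) .id))

theorem primrec_toCode : Primrec Form.toCode := Primrec.encode

theorem primrec_list_prod : Primrec (List.prod : List ℕ → ℕ) :=
  (list_foldr .id (const 1) (nat_mul.comp (fst.comp snd) (snd.comp snd)).to₂).of_eq fun l => by
    induction l <;> simp_all

variable {Γ : Type} [Primcodable Γ]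

theorem primrec_prod_map {ι : Type} {f : ι → Γ → ℕ} (l : List ι) (hf : ∀ i, Primrec (f i)) :
    Primrec fun z => (l.map fun i => f i z).prod := by
  induction l with
  | nil => exact const 1
  | cons i l ih => simpa using nat_mul.comp (hf i) ih

theorem primrecPred_forall_mem {ι : Type*} {p : ι → Γ → Prop} (l : List ι)
    (hp : ∀ i ∈ l, PrimrecPred (p i)) : PrimrecPred fun z => ∀ i ∈ l, p i z := by
  induction l with
  | nil => exact (Primrec.eq.comp (const 0) (const 0)).of_eq (by simp)
  | cons i l ih =>
    exact ((hp i (List.mem_cons_self ..)).and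
      (ih fun j hj => hp j (List.mem_cons_of_mem _ hj))).of_eq (by simp)

theorem primrecPred_mem {f : Γ → ℕ} {l : Γ → List ℕ} (hf : Primrec f) (hl : Primrec l) :
    PrimrecPred fun z => f z ∈ l z :=
  ((PrimrecRel.exists_mem_list Primrec.eq).comp hl hf).of_eq (by simp)

theorem primrecPred_imp {p q : Γ → Prop} (hp : PrimrecPred p) (hq : PrimrecPred q) :
    PrimrecPred fun z => p z → q z :=
  (hp.not.or hq).of_eq fun _ => imp_iff_not_or.symm

theorem primrecPred_forall_mem_list {β : Type} [Primcodable β] {l : Γ → List β}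
    {p : Γ → β → Prop} (hl : Primrec l) (hp : PrimrecPred fun y : Γ × β => p y.1 y.2) :
    PrimrecPred fun z => ∀ b ∈ l z, p z b := by
  have h : PrimrecRel fun (b : β) (z : Γ) => p z b := hp.comp (pair snd fst)
  exact (PrimrecRel.forall_mem_list h).comp hl .id

theorem primrecPred_forall_lt {n : Γ → ℕ} {p : Γ → ℕ → Prop} (hn : Primrec n)
    (hp : PrimrecPred fun y : Γ × ℕ => p y.1 y.2) : PrimrecPred fun z => ∀ t < n z, p z t :=
  (primrecPred_forall_mem_list (list_range.comp hn) hp).of_eq (by simp)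

/-- A family of values is primitive recursive in each of its variables. -/
structure PrimrecVals {V : Type} (ν : Γ → Vals V) : Prop where
  a : ∀ v, Primrec fun z => (ν z).a v
  x : ∀ v, Primrec fun z => (ν z).x v
  p : ∀ v, Primrec fun z => (ν z).p v

variable {V : Type} {ν : Γ → Vals V}

theorem PrimrecVals.code (h : PrimrecVals ν) (t : FormTerm V) :
    Primrec fun z => t.code (ν z).a := by
  have key : ∀ u v m, Primrec fun z => 5 * Nat.pair ((ν z).a u) ((ν z).a v) + m := fun u v m =>
    nat_add.comp (nat_mul.comp (const 5) (Primrec₂.natPair.comp (h.a u) (h.a v))) (const m)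
  cases t with
  | var v => exact h.a v
  | top => exact const 0
  | bot => exact const 1
  | one => exact const 2
  | zero => exact const 3
  | conj u v => exact key u v 5
  | disj u v => exact key u v 6
  | fusion u v => exact key u v 7
  | imp u v => exact key u v 8

theorem PrimrecVals.sucCode (h : PrimrecVals ν) (s : SucTerm V) :
    Primrec fun z => s.code (ν z) := by
  cases s with
  | none => exact const 0
  | some t => exact succ.comp (h.code t)
  | var v => exact h.p v

theorem PrimrecVals.value (h : PrimrecVals ν) {L : Γ → ℕ} (hL : Primrec L) (s : SeqTerm V) :
    Primrec fun z => s.value (L z) (ν z) :=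
  Primrec₂.natPair.comp
    (nat_mod.comp (nat_mul.comp
      (primrec_prod_map s.fms fun t => primrec_fermatNumber.comp (h.code t))
      (primrec_prod_map s.mvs fun v => h.x v)) hL)
    (h.sucCode s.suc)

theorem PrimrecVals.hypValue (h : PrimrecVals ν) {L L' k : Γ → ℕ} (hL : Primrec L)
    (hL' : Primrec L') (hk : Primrec k) (l : List (SeqTerm V)) :
    Primrec fun z => hypValue (L z) (L' z) (ν z) (k z) l :=
  nat_mod.comp (nat_mul.comp
    (primrec_prod_map l fun s => primrec_fermatNumber.comp (h.value hL s)) hk) hL'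

theorem primrec_mval {L : Γ → ℕ} {X : Γ → List Form} (hL : Primrec L) (hX : Primrec X) :
    Primrec fun z => mval (L z) (X z : Multiset Form) :=
  (nat_mod.comp (primrec_list_prod.comp (list_map hX
    (primrec_fermatNumber.comp (primrec_toCode.comp snd)).to₂)) hL).of_eq fun z => by
      simp [mval, fermatProd, Function.comp_def]

theorem primrec_hval {L L' : Γ → ℕ} {w : Γ → Written} (hL : Primrec L) (hL' : Primrec L')
    (hw : Primrec w) : Primrec fun z => hval (L z) (L' z) (w z).denote :=
  (nat_mod.comp (primrec_list_prod.comp (list_map hw (primrec_fermatNumber.comp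
    (Primrec₂.natPair.comp (primrec_mval (hL.comp fst) (fst.comp snd))
      (Primrec.encode.comp (snd.comp snd)))).to₂)) hL').of_eq fun z => by
      simp [hval, fermatProd, Function.comp_def, Written.denote, sval]

theorem primrecPred_below {c : Γ → ℕ} {w : Γ → Written} (hc : Primrec c) (hw : Primrec w) :
    PrimrecPred fun z => Below (c z) (w z).denote :=
  (primrecPred_forall_mem_list hw
    (p := fun z q => (∀ A ∈ q.1, A.toCode < c z) ∧ encode q.2 < c z + 1)
    ((primrecPred_forall_mem_list (fst.comp snd)
      (p := fun (y : Γ × (List Form × Option Form)) A => A.toCode < c y.1)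
      (nat_lt.comp (primrec_toCode.comp snd) (hc.comp (fst.comp fst)))).and
    (nat_lt.comp (Primrec.encode.comp (snd.comp snd)) (succ.comp (hc.comp fst))))).of_eq
    fun _ => below_denote.symm

/-- Projections of decidable relations are recursively enumerable, by unbounded search. -/
theorem rePred_exists {α β : Type} [Primcodable α] [Primcodable β] {p : α → β → Prop}
    (hp : PrimrecPred fun y : α × β => p y.1 y.2) : REPred fun a => ∃ b, p a b := by
  classical
  have hd : Primrec fun y : α × ℕ =>
      Option.casesOn (motive := fun _ => Bool) (decode (α := β) y.2) false
        fun b => decide (p y.1 b) :=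
    option_casesOn (Primrec.decode.comp snd) (const false)
      (hp.decide.comp (pair (fst.comp fst) snd)).to₂
  have h : Partrec fun a => Nat.rfind fun n => Part.some
      (Option.casesOn (motive := fun _ => Bool) (decode (α := β) n) false
        fun b => decide (p a b)) :=
    Partrec.rfind hd.to_comp.partrec
  refine h.dom_re.of_eq fun a => ?_
  refine Nat.rfind_dom.trans ?_
  constructor
  · rintro ⟨n, hn, -⟩
    cases hb : decode (α := β) n with
    | none => simp [hb] at hn
    | some b => exact ⟨b, by simpa [hb] using hn⟩
  · rintro ⟨b, hb⟩
    exact ⟨encode b, by simpa using hb, fun _ => trivial⟩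

end Primrec

/-! ### Derivability is recursively enumerable -/

/-- A numbering of the variables of a clause in their three sorts, with one more number for the
side hypersequent. -/
noncomputable def Clause.idx (σ : Clause) : Option (σ.V × Fin 3) ≃
    Fin (Nat.card (Option (σ.V × Fin 3))) :=
  haveI := σ.fin
  Finite.equivFin _

/-- Written data for a rule instance: lists of formulas, of multisets and of succedents from which
the variables are read off, and the side hypersequent. -/
abbrev Params : Type := List Form × List (List Form) × List (Option Form) × Written

/-- The instantiation read off from written data, with default entries beyond the lists. -/
noncomputable def Clause.inst (σ : Clause) (q : Params) : Inst σ.V :=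
  ⟨fun v => q.1.getD (σ.idx (some (v, 0))) .top,
    fun v => (q.2.1.getD (σ.idx (some (v, 0))) [] : List Form),
    fun v => q.2.2.1.getD (σ.idx (some (v, 0))) none⟩

theorem exists_getD {ι α : Type} {n : ℕ} (e : ι → Fin n) (he : e.Injective) (f : ι → α) (d : α) :
    ∃ l : List α, ∀ i, l.getD (e i) d = f i := by
  classical
  refine ⟨List.ofFn fun k => if h : ∃ i, e i = k then f h.choose else d, fun i => ?_⟩
  have h : ∃ j, e j = e i := ⟨i, rfl⟩
  simp [List.getD_eq_getElem?_getD, he h.choose_spec]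

theorem Clause.exists_inst (σ : Clause) (ρ : Inst σ.V) (H : Hypersequent) :
    ∃ q : Params, σ.inst q = ρ ∧ q.2.2.2.denote = H := by
  have he : Function.Injective fun v => σ.idx (some (v, 0)) := fun u v h => by
    simpa using σ.idx.injective h
  obtain ⟨l1, h1⟩ := exists_getD _ he ρ.A .top
  obtain ⟨l2, h2⟩ := exists_getD _ he (fun v => (ρ.X v).toList) []
  obtain ⟨l3, h3⟩ := exists_getD _ he ρ.P none
  obtain ⟨w, hw⟩ := exists_written H
  refine ⟨(l1, l2, l3, w), ?_, hw⟩
  simp only [Clause.inst, h1, h2, h3, Multiset.coe_toList]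

open Classical in
/-- The values of the hypersequents that follow, by instances with the data `q`, from those with
values in `acc`. -/
noncomputable def deriveStep (C : List Clause) (q : Params) (acc : List ℕ) : List ℕ :=
  C.foldr (fun σ r =>
    if ∀ l ∈ σ.prems, hval 0 0 (hypEval (σ.inst q) q.2.2.2.denote l) ∈ acc
    then hval 0 0 (hypEval (σ.inst q) q.2.2.2.denote σ.concl) :: r else r) acc

/-- The values of the hypersequents derived by the successive instances in a list, last first. -/
noncomputable def derive (C : List Clause) (qs : List Params) : List ℕ :=
  qs.foldr (deriveStep C) []

theorem mem_deriveStep {C : List Clause} {q : Params} {acc : List ℕ} {g : ℕ} :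
    g ∈ deriveStep C q acc ↔ g ∈ acc ∨ ∃ σ ∈ C,
      (∀ l ∈ σ.prems, hval 0 0 (hypEval (σ.inst q) q.2.2.2.denote l) ∈ acc) ∧
        g = hval 0 0 (hypEval (σ.inst q) q.2.2.2.denote σ.concl) := by
  induction C with
  | nil => simp [deriveStep]
  | cons σ C ih =>
    rw [deriveStep, List.foldr_cons, ← deriveStep]
    split_ifs with h
    · rw [List.mem_cons, ih]
      simp only [List.mem_cons, exists_eq_or_imp]
      tauto
    · rw [ih]
      simp only [List.mem_cons, exists_eq_or_imp, h, false_and, false_or]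

theorem mem_derive_append {C : List Clause} {qs qs' : List Params} {g : ℕ}
    (h : g ∈ derive C qs ∨ g ∈ derive C qs') : g ∈ derive C (qs ++ qs') := by
  induction qs generalizing g with
  | nil => simpa [derive] using h
  | cons q qs ih =>
    rw [List.cons_append, derive, List.foldr_cons, ← derive, mem_deriveStep]
    rcases h with h | h
    · rw [derive, List.foldr_cons, ← derive, mem_deriveStep] at h
      rcases h with h | ⟨σ, hσ, h, hg⟩
      · exact .inl (ih (.inl h))
      · exact .inr ⟨σ, hσ, fun l hl => ih (.inl (h l hl)), hg⟩
    · exact .inl (ih (.inr h))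

/-- Since values without reduction determine hypersequents, derivability can be checked on them. -/
theorem der_iff_exists_derive {C : List Clause} {H : Hypersequent} :
    Der C H ↔ ∃ qs, hval 0 0 H ∈ derive C qs := by
  constructor
  · intro h
    induction h with
    | step σ hσ ρ H _ ih =>
      have key : ∀ ls : List (List (SeqTerm σ.V)),
          (∀ l ∈ ls, ∃ qs, hval 0 0 (hypEval ρ H l) ∈ derive C qs) →
            ∃ qs, ∀ l ∈ ls, hval 0 0 (hypEval ρ H l) ∈ derive C qs := by
        intro ls
        induction ls with
        | nil => intro _; exact ⟨[], by simp⟩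
        | cons l ls ihl =>
          intro h
          obtain ⟨qs, hqs⟩ := h l (List.mem_cons_self ..)
          obtain ⟨qs', hqs'⟩ := ihl fun l hl => h l (List.mem_cons_of_mem _ hl)
          refine ⟨qs ++ qs', fun t ht => mem_derive_append ?_⟩
          rcases List.mem_cons.1 ht with rfl | ht
          · exact .inl hqs
          · exact .inr (hqs' t ht)
      obtain ⟨qs, hqs⟩ := key _ ih
      obtain ⟨q, rfl, rfl⟩ := σ.exists_inst ρ H
      refine ⟨q :: qs, ?_⟩
      rw [derive, List.foldr_cons, ← derive, mem_deriveStep]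
      exact .inr ⟨σ, hσ, hqs, rfl⟩
  · rintro ⟨qs, hqs⟩
    have key : ∀ g ∈ derive C qs, ∃ G, Der C G ∧ hval 0 0 G = g := by
      clear hqs
      induction qs with
      | nil => simp [derive]
      | cons q qs ih =>
        intro g hg
        rw [derive, List.foldr_cons, ← derive, mem_deriveStep] at hg
        rcases hg with hg | ⟨σ, hσ, h, rfl⟩
        · exact ih g hg
        · refine ⟨_, .step σ hσ _ _ fun l hl => ?_, rfl⟩
          obtain ⟨G, hG, hv⟩ := ih _ (h l hl)
          exact hval_zero_injective hv ▸ hG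
    obtain ⟨G, hG, hv⟩ := key _ hqs
    exact hval_zero_injective hv ▸ hG

section Primrec

open Primrec

theorem Clause.primrecVals_inst (σ : Clause) :
    PrimrecVals fun z : Params × List ℕ => (σ.inst z.1).vals 0 where
  a _ := primrec_toCode.comp ((list_getD Form.top).comp (fst.comp fst) (const _))
  x _ := primrec_mval (const 0)
    ((list_getD ([] : List Form)).comp (fst.comp (snd.comp fst)) (const _))
  p _ := Primrec.encode.comp
    ((list_getD (none : Option Form)).comp (fst.comp (snd.comp (snd.comp fst))) (const _))

theorem primrec_deriveStep (C : List Clause) : Primrec₂ (deriveStep C) := by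
  classical
  change Primrec fun z : Params × List ℕ => deriveStep C z.1 z.2
  induction C with
  | nil => exact snd
  | cons σ C ih =>
    have hk : Primrec fun z : Params × List ℕ => hval 0 0 z.1.2.2.2.denote :=
      primrec_hval (const 0) (const 0) (snd.comp (snd.comp (snd.comp fst)))
    have hv : ∀ l : List (SeqTerm σ.V), Primrec fun z : Params × List ℕ =>
        hval 0 0 (hypEval (σ.inst z.1) z.1.2.2.2.denote l) := fun l =>
      (σ.primrecVals_inst.hypValue (const 0) (const 0) hk l).of_eq fun z =>
        (hval_hypEval _ _ _ _ _).symm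
    exact Primrec.ite (primrecPred_forall_mem σ.prems fun l _ => primrecPred_mem (hv l) snd)
      (list_cons.comp (hv _) ih) ih

theorem primrec_derive (C : List Clause) : Primrec (derive C) :=
  list_foldr .id (const []) ((primrec_deriveStep C).comp (fst.comp snd) (snd.comp snd)).to₂

theorem rePred_der (C : List Clause) : REPred fun w : Written => Der C w.denote :=
  (rePred_exists (p := fun (w : Written) qs => hval 0 0 w.denote ∈ derive C qs)
    (primrecPred_mem (primrec_hval (const 0) (const 0) fst) ((primrec_derive C).comp snd))).of_eq
    fun _ => der_iff_exists_derive.symm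

end Primrec

/-! ### Underivability is recursively enumerable -/

/-- The digit of `t` with index `i` in base `n`. -/
def digit (n t i : ℕ) : ℕ := t / n ^ i % n

theorem exists_digits {n m : ℕ} (f : Fin m → ℕ) (hf : ∀ i, f i < n) :
    ∃ t < n ^ m, ∀ i : Fin m, digit n t i = f i := by
  let t := finFunctionFinEquiv fun i => (⟨f i, hf i⟩ : Fin n)
  refine ⟨t, t.isLt, fun i => ?_⟩
  exact congrArg Fin.val
    (congrFun (finFunctionFinEquiv.symm_apply_apply fun i => (⟨f i, hf i⟩ : Fin n)) i)

/-- The values of the variables of a clause, as the digits of a number `t` in base `n`. -/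
noncomputable def Clause.digitVals (σ : Clause) (n t : ℕ) : Vals σ.V :=
  ⟨fun v => digit n t (σ.idx (some (v, 0))), fun v => digit n t (σ.idx (some (v, 1))),
    fun v => digit n t (σ.idx (some (v, 2)))⟩

theorem Clause.exists_digitVals (σ : Clause) {n : ℕ} (ν : Vals σ.V) (k : ℕ)
    (ha : ∀ v, ν.a v < n) (hx : ∀ v, ν.x v < n) (hp : ∀ v, ν.p v < n) (hk : k < n) :
    ∃ t < n ^ Nat.card (Option (σ.V × Fin 3)),
      σ.digitVals n t = ν ∧ digit n t (σ.idx none) = k := by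
  let f : Option (σ.V × Fin 3) → ℕ
    | none => k
    | some (v, 0) => ν.a v
    | some (v, 1) => ν.x v
    | some (v, 2) => ν.p v
  have hf : ∀ i, f i < n := by
    rintro (_ | ⟨v, i⟩)
    · exact hk
    · fin_cases i
      · exact ha v
      · exact hx v
      · exact hp v
  obtain ⟨t, ht, h⟩ := exists_digits (fun i => f (σ.idx.symm i)) fun i => hf _
  have h' : ∀ i, digit n t (σ.idx i) = f i := fun i => by rw [h, Equiv.symm_apply_apply]
  refine ⟨t, ht, ?_, h' none⟩
  simp only [Clause.digitVals, h', f]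

/-- The value-level counterpart of `Sequent.Below`: formulas have codes below `c`, and
multiset-variables have values from the list `EM`. -/
def SeqTerm.Ok {V : Type} (c : ℕ) (EM : List ℕ) (ν : Vals V) (s : SeqTerm V) : Prop :=
  (∀ t ∈ s.fms, t.code ν.a < c) ∧ (∀ v ∈ s.mvs, ν.x v ∈ EM) ∧ s.suc.code ν < c + 1

/-- A finite table refuting derivability over the formulas with codes below `c`: lists `EM` and
`EK` containing the values of all multisets modulo `L` and of all hypersequents modulo `L'`, and a
list `D` of hypersequent values that is closed under the rules. The number `t` in `rule` runs over
the values of all variables, as its digits in a base above `L`, `L'` and `c`. -/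
structure IsModel (C : List Clause) (c L L' : ℕ) (EM EK D : List ℕ) : Prop where
  pos : 0 < L ∧ 0 < L'
  one_mem : 1 % L ∈ EM ∧ 1 % L' ∈ EK
  ant : ∀ x ∈ EM, ∀ a < c, (Nat.fermatNumber a * x) % L ∈ EM
  hyp : ∀ k ∈ EK, ∀ x ∈ EM, ∀ p < c + 1, (Nat.fermatNumber (Nat.pair x p) * k) % L' ∈ EK
  rule : ∀ σ ∈ C, ∀ t < (L + L' + c + 1) ^ Nat.card (Option (σ.V × Fin 3)),
    digit (L + L' + c + 1) t (σ.idx none) ∈ EK →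
    (∀ l ∈ σ.concl :: σ.prems, ∀ s ∈ l, s.Ok c EM (σ.digitVals (L + L' + c + 1) t)) →
    (∀ l ∈ σ.prems, hypValue L L' (σ.digitVals (L + L' + c + 1) t)
      (digit (L + L' + c + 1) t (σ.idx none)) l ∈ D) →
    hypValue L L' (σ.digitVals (L + L' + c + 1) t)
      (digit (L + L' + c + 1) t (σ.idx none)) σ.concl ∈ D

/-- The values with the codes of formulas and succedents cut off at `c`. -/
def Vals.clamp {V : Type} (c : ℕ) (ν : Vals V) : Vals V :=
  ⟨fun v => min (ν.a v) c, ν.x, fun v => min (ν.p v) c⟩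

theorem FormTerm.code_clamp {V : Type} {c : ℕ} {ν : Vals V} {t : FormTerm V}
    (h : t.code ν.a < c) : t.code (ν.clamp c).a = t.code ν.a := by
  have key : ∀ u v, Nat.pair (ν.a u) (ν.a v) < c →
      Nat.pair (min (ν.a u) c) (min (ν.a v) c) = Nat.pair (ν.a u) (ν.a v) := by
    intro u v h
    rw [min_eq_left ((Nat.left_le_pair _ _).trans h.le),
      min_eq_left ((Nat.right_le_pair _ _).trans h.le)]
  cases t with
  | var v => exact min_eq_left h.le
  | top | bot | one | zero => rfl
  | conj u v | disj u v | fusion u v | imp u v =>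
    simp only [code] at h ⊢
    have := key u v (by omega)
    simp only [Vals.clamp, this]

theorem SucTerm.code_clamp {V : Type} {c : ℕ} {ν : Vals V} {s : SucTerm V}
    (h : s.code ν < c + 1) : s.code (ν.clamp c) = s.code ν := by
  cases s with
  | none => rfl
  | some t =>
    simp only [code] at h ⊢
    rw [FormTerm.code_clamp (by omega)]
  | var v => exact min_eq_left (Nat.lt_succ_iff.1 h)

theorem SeqTerm.Ok.clamp {V : Type} {c : ℕ} {EM : List ℕ} {ν : Vals V} {s : SeqTerm V}
    (h : s.Ok c EM ν) : s.Ok c EM (ν.clamp c) := by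
  refine ⟨fun t ht => ?_, h.2.1, ?_⟩
  · rw [FormTerm.code_clamp (h.1 t ht)]; exact h.1 t ht
  · rw [SucTerm.code_clamp h.2.2]; exact h.2.2

theorem SeqTerm.value_clamp {V : Type} {c L : ℕ} {EM : List ℕ} {ν : Vals V} {s : SeqTerm V}
    (h : s.Ok c EM ν) : s.value L (ν.clamp c) = s.value L ν := by
  rw [SeqTerm.value, SeqTerm.value, SucTerm.code_clamp h.2.2,
    List.map_congr_left fun t ht => by rw [FormTerm.code_clamp (h.1 t ht)]]
  rfl

theorem hypValue_congr {V : Type} {L L' k : ℕ} {ν ν' : Vals V} {l : List (SeqTerm V)}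
    (h : ∀ s ∈ l, s.value L ν = s.value L ν') :
    hypValue L L' ν k l = hypValue L L' ν' k l := by
  rw [hypValue, hypValue, List.map_congr_left fun s hs => by rw [h s hs]]

section Sound

variable {C : List Clause} {c L L' : ℕ} {EM EK D : List ℕ}

theorem IsModel.mval_mem (h : IsModel C c L L' EM EK D) {X : Multiset Form}
    (hX : ∀ A ∈ X, A.toCode < c) : mval L X ∈ EM := by
  induction X using Multiset.induction with
  | empty => exact h.one_mem.1
  | cons A X ih =>
    rw [mval_cons]
    exact h.ant _ (ih fun B hB => hX B (Multiset.mem_cons_of_mem hB)) _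
      (hX A (Multiset.mem_cons_self _ _))

theorem IsModel.hval_mem (h : IsModel C c L L' EM EK D) {H : Hypersequent}
    (hH : Below c H) : hval L L' H ∈ EK := by
  induction H using Multiset.induction with
  | empty => exact h.one_mem.2
  | cons S H ih =>
    rw [hval_cons]
    have hS := hH S (Multiset.mem_cons_self _ _)
    exact h.hyp _ (ih fun T hT => hH T (Multiset.mem_cons_of_mem hT)) _ (h.mval_mem hS.1) _ hS.2

/-- Derivations over the formulas with codes below `c` stay inside the model; by the subformula
property they involve no other formulas. -/
theorem IsModel.sound (hC : ∀ σ ∈ C, σ.Analytic) (h : IsModel C c L L' EM EK D)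
    {H : Hypersequent} (hd : Der C H) (hH : Below c H) : hval L L' H ∈ D := by
  induction hd with
  | step σ hσ ρ H _ ih =>
    have hprem := hC σ hσ c ρ H hH
    have hok : ∀ l ∈ σ.concl :: σ.prems, ∀ s ∈ l, s.Ok c EM (ρ.vals L) := by
      intro l hl s hs
      have hb : Below c (hypEval ρ H l) := by
        rcases List.mem_cons.1 hl with rfl | hl
        · exact hH
        · exact hprem l hl
      have := below_eval.1 ((below_hypEval.1 hb).1 s hs)
      refine ⟨fun t ht => ?_, fun v hv => h.mval_mem (this.2.1 v hv), ?_⟩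
      · have := this.1 t ht
        rwa [FormTerm.toCode_eval] at this
      · have := this.2.2
        rwa [SucTerm.encode_eval L] at this
    have hLt : ∀ X, mval L X < L + L' + c + 1 := fun X => by
      have := Nat.mod_lt (fermatProd (X.map Form.toCode)) h.pos.1
      rw [mval]
      omega
    have hKt : hval L L' H < L + L' + c + 1 := by
      have := Nat.mod_lt (fermatProd (H.map (sval L))) h.pos.2
      rw [hval]
      omega
    -- variables that do not occur in the rule are unbounded, so the values are cut off first
    obtain ⟨t, ht, hν, hk⟩ := σ.exists_digitVals ((ρ.vals L).clamp c) (hval L L' H)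
      (fun v => (min_le_right _ _).trans_lt (by omega)) (fun v => hLt _)
      (fun v => (min_le_right _ _).trans_lt (by omega)) hKt
    have hval' : ∀ l ∈ σ.concl :: σ.prems,
        hypValue L L' ((ρ.vals L).clamp c) (hval L L' H) l = hval L L' (hypEval ρ H l) := by
      intro l hl
      rw [hval_hypEval]
      exact hypValue_congr fun s hs => SeqTerm.value_clamp (hok l hl s hs)
    have := h.rule σ hσ t ht
    rw [hν, hk, hval' _ (List.mem_cons_self ..)] at this
    refine this (h.hval_mem (below_hypEval.1 hH).2) (fun l hl s hs => (hok l hl s hs).clamp)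
      fun l hl => ?_
    rw [hval' l (List.mem_cons_of_mem _ hl)]
    exact ih l hl (hprem l hl)

end Sound

theorem exists_list_of_lt {p : ℕ → Prop} {n : ℕ} (hp : ∀ i, p i → i < n) :
    ∃ l : List ℕ, ∀ i, i ∈ l ↔ p i := by
  have hf : {i | p i}.Finite := (Set.finite_lt_nat n).subset hp
  exact ⟨hf.toFinset.toList, fun i => by simp⟩

/-- If equality of values modulo `L, L'` preserves derivability over the formulas with codes below
`c`, then the values of the derivable hypersequents form a finite model. -/
theorem exists_isModel {C : List Clause} {c L L' : ℕ} (hL : 0 < L) (hL' : 0 < L')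
    (hv : ∀ H H', Below c H → Below c H' → hval L L' H = hval L L' H' → Der C H → Der C H') :
    ∃ EM EK D, IsModel C c L L' EM EK D ∧
      ∀ H, Below c H → (hval L L' H ∈ D → Der C H) := by
  obtain ⟨EM, hEM⟩ := exists_list_of_lt
    (p := fun i => ∃ X : Multiset Form, (∀ A ∈ X, A.toCode < c) ∧ mval L X = i) (n := L)
    (by rintro _ ⟨X, -, rfl⟩; exact Nat.mod_lt _ hL)
  obtain ⟨EK, hEK⟩ := exists_list_of_lt
    (p := fun i => ∃ H, Below c H ∧ hval L L' H = i) (n := L')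
    (by rintro _ ⟨X, -, rfl⟩; exact Nat.mod_lt _ hL')
  obtain ⟨D, hD⟩ := exists_list_of_lt
    (p := fun i => ∃ H, Below c H ∧ Der C H ∧ hval L L' H = i) (n := L')
    (by rintro _ ⟨X, -, -, rfl⟩; exact Nat.mod_lt _ hL')
  have hDer : ∀ H, Below c H → (hval L L' H ∈ D → Der C H) := by
    intro H hH hm
    obtain ⟨G, hG, hd, he⟩ := (hD _).1 hm
    exact hv G H hG hH he hd
  refine ⟨EM, EK, D, ⟨⟨hL, hL'⟩, ⟨?_, ?_⟩, ?_, ?_, ?_⟩, hDer⟩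
  · exact (hEM _).2 ⟨0, by simp, rfl⟩
  · exact (hEK _).2 ⟨0, by simp [Below], rfl⟩
  · intro x hx a ha
    obtain ⟨X, hX, rfl⟩ := (hEM _).1 hx
    refine (hEM _).2 ⟨Form.ofCode a ::ₘ X, ?_, by rw [mval_cons, Form.toCode_ofCode]⟩
    intro A hA
    rcases Multiset.mem_cons.1 hA with rfl | hA
    · rwa [Form.toCode_ofCode]
    · exact hX A hA
  · intro k hk x hx p hp
    obtain ⟨H, hH, rfl⟩ := (hEK _).1 hk
    obtain ⟨X, hX, rfl⟩ := (hEM _).1 hx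
    refine (hEK _).2 ⟨(X ⇛ Denumerable.ofNat (Option Form) p) ::ₘ H, ?_, ?_⟩
    · intro S hS
      rcases Multiset.mem_cons.1 hS with rfl | hS
      · exact ⟨hX, by rwa [Denumerable.encode_ofNat]⟩
      · exact hH S hS
    · rw [hval_cons, sval, Denumerable.encode_ofNat]
  · intro σ hσ t _
    generalize σ.digitVals (L + L' + c + 1) t = ν
    generalize digit (L + L' + c + 1) t (σ.idx none) = k
    intro hk hok hprem
    obtain ⟨H, hH, rfl⟩ := (hEK _).1 hk
    -- representatives for the multiset-variables whose value has one
    have hX : ∀ v, ∃ X : Multiset Form,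
        ν.x v ∈ EM → (∀ A ∈ X, A.toCode < c) ∧ mval L X = ν.x v := by
      intro v
      by_cases h : ν.x v ∈ EM
      · obtain ⟨X, hX⟩ := (hEM _).1 h
        exact ⟨X, fun _ => hX⟩
      · exact ⟨0, fun h' => absurd h' h⟩
    choose X hX using hX
    let ρ : Inst σ.V := ⟨fun v => Form.ofCode (ν.a v), X,
      fun v => Denumerable.ofNat (Option Form) (ν.p v)⟩
    have ha : (ρ.vals L).a = ν.a := funext fun v => Form.toCode_ofCode _
    have hp : (ρ.vals L).p = ν.p := funext fun v => Denumerable.encode_ofNat _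
    have hsuc : ∀ s : SucTerm σ.V, s.code (ρ.vals L) = s.code ν := by
      rintro (_ | t | v)
      · rfl
      · simp only [SucTerm.code, ha]
      · simp only [SucTerm.code, hp]
    have hvalue : ∀ l ∈ σ.concl :: σ.prems,
        hypValue L L' ν (hval L L' H) l = hval L L' (hypEval ρ H l) := by
      intro l hl
      rw [hval_hypEval]
      refine hypValue_congr fun s hs => ?_
      rw [SeqTerm.value, SeqTerm.value, hsuc, ha,
        List.map_congr_left fun v hv' => ((hX v ((hok l hl s hs).2.1 v hv')).2).symm]
      rfl
    have hbelow : ∀ l ∈ σ.concl :: σ.prems, Below c (hypEval ρ H l) := by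
      intro l hl
      refine below_hypEval.2 ⟨fun s hs => below_eval.2 ⟨fun t ht => ?_, fun v hv' => ?_, ?_⟩, hH⟩
      · have := (hok l hl s hs).1 t ht
        rw [FormTerm.toCode_eval]
        change t.code (ρ.vals L).a < c
        rwa [ha]
      · exact (hX v ((hok l hl s hs).2.1 v hv')).1
      · rw [SucTerm.encode_eval L, hsuc]
        exact (hok l hl s hs).2.2
    rw [hvalue _ (List.mem_cons_self ..)]
    refine (hD _).2 ⟨_, hbelow _ (List.mem_cons_self ..), .step σ hσ ρ H fun l hl => ?_, rfl⟩
    have hl' := List.mem_cons_of_mem σ.concl hl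
    exact hDer _ (hbelow l hl') (hvalue l hl' ▸ hprem l hl)

theorem exists_below (H : Hypersequent) : ∃ c, Below c H := by
  have hmono : ∀ {c c' : ℕ} {S : Sequent}, c ≤ c' → S.Below c → S.Below c' := fun h hS =>
    ⟨fun A hA => (hS.1 A hA).trans_le h, hS.2.trans_le (by omega)⟩
  have hX : ∀ X : Multiset Form, ∃ c, ∀ A ∈ X, A.toCode < c := by
    intro X
    refine ⟨(X.map Form.toCode).sum + 1, fun A hA => Nat.lt_succ_of_le ?_⟩
    exact Multiset.single_le_sum (fun _ _ => Nat.zero_le _) _ (Multiset.mem_map_of_mem _ hA)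
  induction H using Multiset.induction with
  | empty => exact ⟨0, by simp [Below]⟩
  | cons S H ih =>
    obtain ⟨c, hc⟩ := ih
    obtain ⟨c', hc'⟩ := hX S.ant
    refine ⟨max c (max c' (encode S.suc)), fun T hT => ?_⟩
    rcases Multiset.mem_cons.1 hT with rfl | hT
    · exact ⟨fun A hA => (hc' A hA).trans_le (by omega), by omega⟩
    · exact hmono (by omega) (hc T hT)

section Primrec

open Primrec

/-- The data of a refutation: `c`, `L`, `L'`, `EM`, `EK` and `D`. -/
abbrev Cert : Type := ℕ × ℕ × ℕ × List ℕ × List ℕ × List ℕ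

variable {Γ : Type} [Primcodable Γ]

theorem primrec_digit {n t : Γ → ℕ} (hn : Primrec n) (ht : Primrec t) (i : ℕ) :
    Primrec fun z => digit (n z) (t z) i :=
  have hpow : Primrec₂ ((· ^ ·) : ℕ → ℕ → ℕ) := Primrec₂.unpaired'.1 Nat.Primrec.pow
  nat_mod.comp (nat_div.comp ht (hpow.comp hn (const i))) hn

theorem PrimrecVals.ok {V : Type} {ν : Γ → Vals V} (h : PrimrecVals ν) {c : Γ → ℕ}
    {EM : Γ → List ℕ} (hc : Primrec c) (hE : Primrec EM) (s : SeqTerm V) :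
    PrimrecPred fun z => s.Ok (c z) (EM z) (ν z) :=
  (primrecPred_forall_mem s.fms fun t _ => nat_lt.comp (h.code t) hc).and
    ((primrecPred_forall_mem s.mvs fun v _ => primrecPred_mem (h.x v) hE).and
      (nat_lt.comp (h.sucCode s.suc) (succ.comp hc)))

theorem primrecPred_isModel (C : List Clause) : PrimrecPred fun z : Cert =>
    IsModel C z.1 z.2.1 z.2.2.1 z.2.2.2.1 z.2.2.2.2.1 z.2.2.2.2.2 := by
  have hpow : Primrec₂ ((· ^ ·) : ℕ → ℕ → ℕ) := Primrec₂.unpaired'.1 Nat.Primrec.pow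
  have hc : Primrec fun z : Cert => z.1 := fst
  have hL : Primrec fun z : Cert => z.2.1 := fst.comp snd
  have hL' : Primrec fun z : Cert => z.2.2.1 := fst.comp (snd.comp snd)
  have hEM : Primrec fun z : Cert => z.2.2.2.1 := fst.comp (snd.comp (snd.comp snd))
  have hEK : Primrec fun z : Cert => z.2.2.2.2.1 :=
    fst.comp (snd.comp (snd.comp (snd.comp snd)))
  have hD : Primrec fun z : Cert => z.2.2.2.2.2 :=
    snd.comp (snd.comp (snd.comp (snd.comp snd)))
  have hn : Primrec fun z : Cert => z.2.1 + z.2.2.1 + z.1 + 1 :=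
    succ.comp (nat_add.comp (nat_add.comp hL hL') hc)
  have h1 : PrimrecPred fun z : Cert => 0 < z.2.1 ∧ 0 < z.2.2.1 :=
    (nat_lt.comp (const 0) hL).and (nat_lt.comp (const 0) hL')
  have h2 : PrimrecPred fun z : Cert => 1 % z.2.1 ∈ z.2.2.2.1 ∧ 1 % z.2.2.1 ∈ z.2.2.2.2.1 :=
    (primrecPred_mem (nat_mod.comp (const 1) hL) hEM).and
      (primrecPred_mem (nat_mod.comp (const 1) hL') hEK)
  have h3 : PrimrecPred fun z : Cert => ∀ x ∈ z.2.2.2.1, ∀ a < z.1,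
      (Nat.fermatNumber a * x) % z.2.1 ∈ z.2.2.2.1 :=
    primrecPred_forall_mem_list hEM (primrecPred_forall_lt (hc.comp fst)
      (primrecPred_mem (nat_mod.comp (nat_mul.comp (primrec_fermatNumber.comp snd)
        (snd.comp fst)) (hL.comp (fst.comp fst))) (hEM.comp (fst.comp fst))))
  have h4 : PrimrecPred fun z : Cert => ∀ k ∈ z.2.2.2.2.1, ∀ x ∈ z.2.2.2.1, ∀ p < z.1 + 1,
      (Nat.fermatNumber (Nat.pair x p) * k) % z.2.2.1 ∈ z.2.2.2.2.1 :=
    primrecPred_forall_mem_list hEK (primrecPred_forall_mem_list (hEM.comp fst)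
      (primrecPred_forall_lt (succ.comp (hc.comp (fst.comp fst)))
        (primrecPred_mem (nat_mod.comp (nat_mul.comp
          (primrec_fermatNumber.comp (Primrec₂.natPair.comp (snd.comp fst) snd))
          (snd.comp (fst.comp fst))) (hL'.comp (fst.comp (fst.comp fst))))
          (hEK.comp (fst.comp (fst.comp fst))))))
  have h5 := primrecPred_forall_mem (Γ := Cert) (p := fun σ z =>
    ∀ t < (z.2.1 + z.2.2.1 + z.1 + 1) ^ Nat.card (Option (σ.V × Fin 3)),
      digit (z.2.1 + z.2.2.1 + z.1 + 1) t (σ.idx none) ∈ z.2.2.2.2.1 →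
      (∀ l ∈ σ.concl :: σ.prems, ∀ s ∈ l,
        s.Ok z.1 z.2.2.2.1 (σ.digitVals (z.2.1 + z.2.2.1 + z.1 + 1) t)) →
      (∀ l ∈ σ.prems, hypValue z.2.1 z.2.2.1 (σ.digitVals (z.2.1 + z.2.2.1 + z.1 + 1) t)
        (digit (z.2.1 + z.2.2.1 + z.1 + 1) t (σ.idx none)) l ∈ z.2.2.2.2.2) →
      hypValue z.2.1 z.2.2.1 (σ.digitVals (z.2.1 + z.2.2.1 + z.1 + 1) t)
        (digit (z.2.1 + z.2.2.1 + z.1 + 1) t (σ.idx none)) σ.concl ∈ z.2.2.2.2.2) C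
    (fun σ _ => by
      have hdig : ∀ i, Primrec fun y : Cert × ℕ =>
          digit (y.1.2.1 + y.1.2.2.1 + y.1.1 + 1) y.2 i :=
        primrec_digit (hn.comp fst) snd
      have hν : PrimrecVals fun y : Cert × ℕ =>
          σ.digitVals (y.1.2.1 + y.1.2.2.1 + y.1.1 + 1) y.2 :=
        ⟨fun _ => hdig _, fun _ => hdig _, fun _ => hdig _⟩
      have hval := hν.hypValue (hL.comp fst) (hL'.comp fst) (hdig (σ.idx none))
      refine primrecPred_forall_lt (hpow.comp hn (const _)) ?_
      refine primrecPred_imp (primrecPred_mem (hdig _) (hEK.comp fst)) ?_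
      refine primrecPred_imp (primrecPred_forall_mem _ fun l _ =>
        primrecPred_forall_mem l fun s _ => hν.ok (hc.comp fst) (hEM.comp fst) s) ?_
      exact primrecPred_imp (primrecPred_forall_mem _ fun l _ =>
        primrecPred_mem (hval l) (hD.comp fst)) (primrecPred_mem (hval _) (hD.comp fst)))
  exact (h1.and (h2.and (h3.and (h4.and h5)))).of_eq fun z =>
    ⟨fun ⟨a, b, c, d, e⟩ => ⟨a, b, c, d, e⟩, fun ⟨a, b, c, d, e⟩ => ⟨a, b, c, d, e⟩⟩

/-- A hypersequent is underivable if and only if some finite model refutes it. -/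
theorem rePred_not_derivable (l : List AnalyticRule) :
    REPred fun w : Written => ¬ Derivable {r | r ∈ l} w.denote := by
  have hC : ∀ σ ∈ clausesOf l, σ.Analytic := fun σ => analytic_of_mem_clausesOf
  refine (rePred_exists (p := fun (w : Written) (z : Cert) =>
    IsModel (clausesOf l) z.1 z.2.1 z.2.2.1 z.2.2.2.1 z.2.2.2.2.1 z.2.2.2.2.2 ∧
      Below z.1 w.denote ∧ ¬ hval z.2.1 z.2.2.1 w.denote ∈ z.2.2.2.2.2) ?_).of_eq fun w => ?_
  · exact ((primrecPred_isModel _).comp snd).and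
      ((primrecPred_below (fst.comp snd) fst).and
        (primrecPred_mem (primrec_hval (fst.comp (snd.comp snd))
          (fst.comp (snd.comp (snd.comp snd))) fst)
          (snd.comp (snd.comp (snd.comp (snd.comp (snd.comp snd)))))).not)
  · constructor
    · rintro ⟨z, hz, hb, hn⟩ hd
      exact hn (hz.sound hC (der_iff_derivable.2 hd) hb)
    · intro hn
      obtain ⟨c, hc⟩ := exists_below w.denote
      obtain ⟨L, L', hL, hL', hv⟩ := exists_moduli {r | r ∈ l} c
      obtain ⟨EM, EK, D, hm, hD⟩ := exists_isModel hL hL' fun H H' h h' e hd =>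
        der_iff_derivable.2 (hv H H' h h' e (der_iff_derivable.1 hd))
      exact ⟨(c, L, L', EM, EK, D), hm, hc, fun h => hn (der_iff_derivable.1 (hD _ hc h))⟩

end Primrec

theorem computablePred_derivable {R : Set AnalyticRule} (hR : R.Finite) :
    ComputablePred fun w : Written => Derivable R w.denote := by
  obtain ⟨l, rfl⟩ : ∃ l : List AnalyticRule, {r | r ∈ l} = R :=
    ⟨hR.toFinset.toList, by ext; simp⟩
  exact ComputablePred.computable_iff_re_compl_re'.2
    ⟨(rePred_der _).of_eq fun _ => der_iff_derivable, rePred_not_derivable l⟩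

end HFL

theorem mainTheorem1 (R : Set HFL.AnalyticRule) (hR : R.Finite) :
    ComputablePred (fun w : HFL.Written => HFL.Derivable R w.denote) ∧
    ∀ L : Set HFL.Form, HFL.IsCalculusFor R L → ComputablePred (fun B : HFL.Form => B ∈ L) := by
  refine ⟨HFL.computablePred_derivable hR, fun L hL => ?_⟩
  refine ComputablePred.computable_of_manyOneReducible
    (q := fun w : HFL.Written => HFL.Derivable R w.denote) ⟨fun B => [([], some B)], ?_, ?_⟩
    (HFL.computablePred_derivable hR)
  · exact (Primrec.list_cons.comp (Primrec.pair (.const []) Primrec.option_some)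
      (.const [])).to_comp
  · intro B
    exact hL B
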